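/- Let $(M,d)$, $(N,\partial)$ be pseudometric spaces. For a map $f\colon M\to N$ and $t\ge 0$ put $$\omega_f(t)=\sup\{\partial(f(x),f(y)) : d(x,y)\le t\},\qquad \rho_f(t)=\inf\{\partial(f(x),f(y)) : d(x,y)\ge t\}$$ (with values in $[0,\infty]$, $\inf\emptyset=\infty$). The map $f$ is \emph{coarse} if $\omega_f(t)<\infty$ for all $t\ge 0$; a \emph{coarse embedding} if it is coarse and $\lim_{t\to\infty}\rho_f(t)=\infty$; and a \emph{coarse equivalence} if it is a coarse embedding and $\sup_{y\in N}\inf_{x\in M}\partial(y,f(x))<\infty$. The space $(M,d)$ (or $d$ itself) is \emph{stable} if $$\lim_{i,\mathcal U}\lim_{j,\mathcal V}d(x_i,y_j)=\lim_{j,\mathcal V}\lim_{i,\mathcal U}d(x_i,y_j)$$ for all $d$-bounded sequences $(x_i)$, $(y_j)$ in $M$ and all nonprincipal ultrafilters $\mathcal U,\mathcal V$ on $\mathbb N$. A (real) Banach space is \emph{stable} if its norm metric is, and a Banach space $Y$ is \emph{superstable} if every Banach space that is finitely representable in $Y$ is stable; here $Z$ is \emph{finitely representable} in $Y$ if for every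 finite-dimensional subspace $E\subseteq Z$ and every $\varepsilon>0$ there is a linear map $T\colon E\to Y$ with $\|e\|\le\|Te\|\le(1+\varepsilon)\|e\|$ for all $e\in E$. A pseudometric $d$ on a Banach space $X$ is \emph{translation-invariant} if $d(x,y)=d(x-y,0)$ for all $x,y\in X$. Let $(X,\|\cdot\|)$ be a Banach space, let $Y$ be a superstable Banach space, and let $f\colon X\to Y$ be a coarse map. Then there exists a translation-invariant stable pseudometric $d$ on $X$ such that $$\rho_f(\|x-y\|)\le d(x,y)\le \omega_f(\|x-y\|)\qquad\text{for all } x,y\in X.$$ In particular, if $X$ coarsely embeds into a superstable Banach space, then there exists a translation-invariant stable pseudometric $d$ on $X$ such that the identity map $\mathrm{Id}\colon (X,\|\cdot\|)\to(X,d)$ is a coarse equivalence. -/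

import Mathlib

open scoped ENNReal Topology

/-- The metric `(x, y) ↦ ‖x - y‖` of a normed space, as a bundled pseudometric. -/
def normMetric (X : Type*) [NormedAddCommGroup X] : PseudoMetric X ℝ where
  toFun x y := ‖x - y‖
  refl' x := by simp
  symm' x y := norm_sub_rev x y
  triangle' x y z := norm_sub_le_norm_sub_add_norm_sub x y z

section Moduli

variable {M N : Type*}

/-- `ω_f(t) = sup {d'(f x, f y) | d(x, y) ≤ t}`, with values in `[0, ∞]`. -/
noncomputable def expansionModulus (d : PseudoMetric M ℝ) (d' : PseudoMetric N ℝ) (f : M → N)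
    (t : ℝ) : ℝ≥0∞ :=
  ⨆ (x : M) (y : M) (_ : d x y ≤ t), ENNReal.ofReal (d' (f x) (f y))

/-- `ρ_f(t) = inf {d'(f x, f y) | d(x, y) ≥ t}`, with values in `[0, ∞]` (and `inf ∅ = ∞`). -/
noncomputable def compressionModulus (d : PseudoMetric M ℝ) (d' : PseudoMetric N ℝ) (f : M → N)
    (t : ℝ) : ℝ≥0∞ :=
  ⨅ (x : M) (y : M) (_ : t ≤ d x y), ENNReal.ofReal (d' (f x) (f y))

/-- `f` is coarse: `ω_f(t) < ∞` for all `t ≥ 0`. -/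
def IsCoarse (d : PseudoMetric M ℝ) (d' : PseudoMetric N ℝ) (f : M → N) : Prop :=
  ∀ t : ℝ, 0 ≤ t → expansionModulus d d' f t < ∞

/-- `f` is expanding: `ρ_f(t) → ∞` as `t → ∞`. -/
def IsExpanding (d : PseudoMetric M ℝ) (d' : PseudoMetric N ℝ) (f : M → N) : Prop :=
  Filter.Tendsto (compressionModulus d d' f) Filter.atTop (𝓝 ∞)

/-- A coarse embedding is a map that is both coarse and expanding. -/
def IsCoarseEmbedding (d : PseudoMetric M ℝ) (d' : PseudoMetric N ℝ) (f : M → N) : Prop :=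
  IsCoarse d d' f ∧ IsExpanding d d' f

/-- `f` is cobounded: the distances of the points of the codomain to the range of `f` are
bounded. -/
def IsCobounded (d' : PseudoMetric N ℝ) (f : M → N) : Prop :=
  (⨆ y : N, ⨅ x : M, ENNReal.ofReal (d' y (f x))) < ∞

/-- A coarse equivalence is a cobounded coarse embedding. -/
def IsCoarseEquivalence (d : PseudoMetric M ℝ) (d' : PseudoMetric N ℝ) (f : M → N) : Prop :=
  IsCoarseEmbedding d d' f ∧ IsCobounded d' f

/-- A sequence that is bounded for the pseudometric `d`. -/
def IsBoundedSeq (d : PseudoMetric M ℝ) (x : ℕ → M) : Prop :=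
  ∃ C : ℝ, ∀ i j, d (x i) (x j) ≤ C

/-- Stability of `(M, d)`: for all bounded sequences `x`, `y` and all nonprincipal ultrafilters
`U`, `V` on `ℕ`, the iterated limits `lim_{i,U} lim_{j,V} d(x_i, y_j)` and
`lim_{j,V} lim_{i,U} d(x_i, y_j)` agree. (All these limits exist, by boundedness; `g`, `h` are the
inner limits and `L` is the common value.) -/
def PseudoMetric.IsStable (d : PseudoMetric M ℝ) : Prop :=
  ∀ x y : ℕ → M, IsBoundedSeq d x → IsBoundedSeq d y →
    ∀ U V : Ultrafilter ℕ, (∀ n, U ≠ pure n) → (∀ n, V ≠ pure n) →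
      ∃ (g h : ℕ → ℝ) (L : ℝ),
        (∀ i, Filter.Tendsto (fun j => d (x i) (y j)) V (𝓝 (g i))) ∧
        (∀ j, Filter.Tendsto (fun i => d (x i) (y j)) U (𝓝 (h j))) ∧
        Filter.Tendsto g U (𝓝 L) ∧ Filter.Tendsto h V (𝓝 L)

end Moduli

/-- `d(x, y) = d(x - y, 0)` for all `x`, `y`. -/
def PseudoMetric.IsTranslationInvariant {X : Type*} [AddGroup X] (d : PseudoMetric X ℝ) : Prop :=
  ∀ x y : X, d x y = d (x - y) 0

/-- `Z` is finitely representable in `Y`: for every `ε > 0`, every finite-dimensional subspace of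
`Z` is `(1 + ε)`-isomorphic to a subspace of `Y`. -/
def FinitelyRepresentable (Z Y : Type*) [NormedAddCommGroup Z] [NormedSpace ℝ Z]
    [NormedAddCommGroup Y] [NormedSpace ℝ Y] : Prop :=
  ∀ E : Submodule ℝ Z, FiniteDimensional ℝ E → ∀ ε : ℝ, 0 < ε →
    ∃ T : E →ₗ[ℝ] Y, ∀ e : E, ‖e‖ ≤ ‖T e‖ ∧ ‖T e‖ ≤ (1 + ε) * ‖e‖

/-- `Y` is superstable: every Banach space that is finitely representable in `Y` is stable.
(Stability concerns countably many points and finite representability passes to subspaces, so only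
separable spaces matter; these have copies in every universe.) -/
def IsSuperstable.{u} (Y : Type u) [NormedAddCommGroup Y] [NormedSpace ℝ Y] : Prop :=
  ∀ (Z : Type u) [NormedAddCommGroup Z] [NormedSpace ℝ Z] [CompleteSpace Z],
    FinitelyRepresentable Z Y → (normMetric Z).IsStable

open Filter MeasureTheory Set

/-! An abelian group is amenable, so the pseudometrics `‖f (x + z) - f (y + z)‖` can be averaged
over `z` with an invariant mean `M` on `X`. The average is translation-invariant, and it lies
between the two moduli because each averaged pseudometric does. All the difficulty is in its
stability (`averagedMetric_isStable`).

First truncate the distances at a level `C`. The arrays `min ‖x i z - y j z‖ C`, one for each `z`,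
lie in a compact metrizable cube, so `M` becomes a probability measure on their closure. Each array
in the closure is a pointwise limit of such arrays, hence consists of truncated distances in an
ultrapower of `Y`. The ultrapower is finitely representable in `Y`, therefore stable, so every array
in the closure has exchangeable iterated limits (`IsSuperstable.hasDoubleLimits_of_tendsto`).

This property passes to expectations (`hasDoubleLimits_integral`). The two iterated weak limits in
`L²` are, by Mazur's lemma, almost everywhere limits of convex combinations, and at each sample
point convex averaging of rows or columns preserves the property (`HasDoubleLimits.average`).

Finally the truncation is removed. A `d`-bounded sequence gives functions of `z` with bounded means
but possibly no common bound, so mass may escape to infinity. Its contribution to either iterated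
limit is the sum of the masses escaping from the two sequences, whatever the order of the limits
(`IsMean.tendsto_iterated_tail`). -/

/-- The limit of a bounded real family along an ultrafilter. -/
noncomputable def ulim {ι : Type*} (U : Ultrafilter ι) (f : ι → ℝ) : ℝ := limUnder (U : Filter ι) f

/-! ### Limits along ultrafilters. -/

section ulim

variable {ι : Type*} {U : Ultrafilter ι} {f g : ι → ℝ} {C : ℝ}

theorem ulim_eq {l : ℝ} (h : Tendsto f U (𝓝 l)) : ulim U f = l := h.limUnder_eq

theorem tendsto_ulim (h : ∀ i, |f i| ≤ C) : Tendsto f U (𝓝 (ulim U f)) := by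
  obtain ⟨l, -, hl⟩ := (isCompact_Icc (a := -C) (b := C)).ultrafilter_le_nhds (U.map f)
    (le_principal_iff.2 (mem_map.2 (univ_mem' fun i => abs_le.1 (h i))))
  have hl' : Tendsto f U (𝓝 l) := hl
  rwa [ulim_eq hl']

theorem abs_ulim_le (h : ∀ i, |f i| ≤ C) : |ulim U f| ≤ C :=
  le_of_tendsto (tendsto_ulim h).abs (Eventually.of_forall h)

theorem ulim_congr (h : f =ᶠ[U] g) : ulim U f = ulim U g := by
  unfold ulim limUnder
  rw [map_congr h]

theorem ulim_pure (i : ι) (f : ι → ℝ) : ulim (pure i) f = f i :=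
  ulim_eq (tendsto_pure_nhds f i)

end ulim

/-! ### Exchangeable iterated limits and means. -/

/-- The two iterated limits of the array along any pair of ultrafilters agree. -/
def HasDoubleLimits (a : ℕ → ℕ → ℝ) : Prop :=
  ∀ U V : Ultrafilter ℕ, ulim U (fun i => ulim V (a i)) = ulim V fun j => ulim U fun i => a i j

theorem HasDoubleLimits.swap {a : ℕ → ℕ → ℝ} (h : HasDoubleLimits a) :
    HasDoubleLimits fun j i => a i j := fun U V => (h V U).symm

/-- Bounded real functions. -/
def IsBoundedFun {ι : Type*} (f : ι → ℝ) : Prop := ∃ C, ∀ i, |f i| ≤ C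

section IsBoundedFun

variable {ι : Type*} {f g : ι → ℝ}

theorem IsBoundedFun.add (hf : IsBoundedFun f) (hg : IsBoundedFun g) :
    IsBoundedFun fun i => f i + g i := by
  obtain ⟨C, hC⟩ := hf
  obtain ⟨D, hD⟩ := hg
  exact ⟨C + D, fun i => (abs_add_le _ _).trans (add_le_add (hC i) (hD i))⟩

theorem IsBoundedFun.const_mul (c : ℝ) (hf : IsBoundedFun f) : IsBoundedFun fun i => c * f i := by
  obtain ⟨C, hC⟩ := hf
  exact ⟨|c| * C, fun i => by rw [abs_mul]; exact mul_le_mul_of_nonneg_left (hC i) (abs_nonneg c)⟩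

theorem IsBoundedFun.sub (hf : IsBoundedFun f) (hg : IsBoundedFun g) :
    IsBoundedFun fun i => f i - g i := by
  simpa [sub_eq_add_neg] using hf.add (hg.const_mul (-1))

theorem isBoundedFun_const (c : ℝ) : IsBoundedFun fun _ : ι => c := ⟨|c|, fun _ => le_rfl⟩

theorem isBoundedFun_of_nonneg_of_le {C : ℝ} (h0 : ∀ i, 0 ≤ f i) (h : ∀ i, f i ≤ C) :
    IsBoundedFun f := ⟨C, fun i => by rw [abs_of_nonneg (h0 i)]; exact h i⟩

end IsBoundedFun

/-- `M` restricts to a mean on the bounded functions: a normalized positive linear functional. -/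
structure IsMean {ι : Type*} (M : (ι → ℝ) → ℝ) : Prop where
  map_add : ∀ f g, IsBoundedFun f → IsBoundedFun g → M (fun z => f z + g z) = M f + M g
  map_mul : ∀ (c : ℝ) f, IsBoundedFun f → M (fun z => c * f z) = c * M f
  nonneg : ∀ f, IsBoundedFun f → (∀ z, 0 ≤ f z) → 0 ≤ M f
  map_one : M (fun _ => 1) = 1

namespace IsMean

variable {ι : Type*} {M : (ι → ℝ) → ℝ} {f g : ι → ℝ}

theorem map_sub (hM : IsMean M) (hf : IsBoundedFun f) (hg : IsBoundedFun g) :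
    M (fun z => f z - g z) = M f - M g := by
  have := hM.map_add f (fun z => -1 * g z) hf (hg.const_mul (-1))
  rw [hM.map_mul _ _ hg] at this
  simpa [sub_eq_add_neg] using this

theorem mono (hM : IsMean M) (hf : IsBoundedFun f) (hg : IsBoundedFun g) (h : ∀ z, f z ≤ g z) :
    M f ≤ M g := by
  have := hM.nonneg _ (hg.sub hf) fun z => sub_nonneg.2 (h z)
  rw [hM.map_sub hg hf] at this
  linarith

theorem map_const (hM : IsMean M) (c : ℝ) : M (fun _ => c) = c := by
  have := hM.map_mul c (fun _ => 1) (isBoundedFun_const 1)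
  simpa [hM.map_one] using this

theorem le_const (hM : IsMean M) {C : ℝ} (hf : IsBoundedFun f) (h : ∀ z, f z ≤ C) : M f ≤ C :=
  (hM.mono hf (isBoundedFun_const C) h).trans_eq (hM.map_const C)

theorem const_le (hM : IsMean M) {C : ℝ} (hf : IsBoundedFun f) (h : ∀ z, C ≤ f z) : C ≤ M f :=
  (hM.map_const C).symm.trans_le (hM.mono (isBoundedFun_const C) hf h)

end IsMean

/-! ### Means as measures on compact sets. -/

/-- The Riesz–Markov–Kakutani theorem for normalized functionals on a compact space. -/
theorem exists_isProbabilityMeasure_integral_eq {A : Type*} [TopologicalSpace A] [CompactSpace A]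
    [T2Space A] [MeasurableSpace A] [BorelSpace A] (Λ : C(A, ℝ) →ₗ[ℝ] ℝ)
    (hpos : ∀ f : C(A, ℝ), (∀ x, 0 ≤ f x) → 0 ≤ Λ f) (h1 : Λ 1 = 1) :
    ∃ μ : Measure A, IsProbabilityMeasure μ ∧ ∀ f : C(A, ℝ), ∫ x, f x ∂μ = Λ f := by
  let toC : CompactlySupportedContinuousMap A ℝ →ₗ[ℝ] C(A, ℝ) :=
    { toFun := fun f => f.toContinuousMap
      map_add' := fun f g => rfl
      map_smul' := fun c f => rfl }
  let Λ' : CompactlySupportedContinuousMap A ℝ →ₚ[ℝ] ℝ :=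
    PositiveLinearMap.mk₀ (Λ.comp toC) fun f hf => hpos _ fun x => hf x
  have key : ∀ f : C(A, ℝ), ∫ x, f x ∂(RealRMK.rieszMeasure Λ') = Λ f := fun f =>
    RealRMK.integral_rieszMeasure Λ' (CompactlySupportedContinuousMap.continuousMapEquiv f)
  refine ⟨RealRMK.rieszMeasure Λ', ⟨?_⟩, key⟩
  have := key 1
  simp only [ContinuousMap.one_apply, integral_const, smul_eq_mul, mul_one, h1] at this
  rw [Measure.real, ENNReal.toReal_eq_one_iff] at this
  exact this

/-- The push-forward of a mean along a map with relatively compact range. -/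
theorem IsMean.exists_measure {ι P : Type*} [TopologicalSpace P] [T2Space P] [MeasurableSpace P]
    [BorelSpace P] {M : (ι → ℝ) → ℝ} (hM : IsMean M) (k : ι → P)
    (hK : IsCompact (closure (range k))) :
    ∃ μ : Measure (closure (range k)), IsProbabilityMeasure μ ∧
      ∀ φ : C(closure (range k), ℝ),
        ∫ x, φ x ∂μ = M fun z => φ ⟨k z, subset_closure (mem_range_self z)⟩ := by
  have : CompactSpace (closure (range k)) := isCompact_iff_compactSpace.1 hK
  have hb : ∀ φ : C(closure (range k), ℝ),
      IsBoundedFun fun z => φ ⟨k z, subset_closure (mem_range_self z)⟩ := fun φ =>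
    ⟨‖φ‖, fun z => φ.norm_coe_le_norm _⟩
  let Λ : C(closure (range k), ℝ) →ₗ[ℝ] ℝ :=
    { toFun := fun φ => M fun z => φ ⟨k z, subset_closure (mem_range_self z)⟩
      map_add' := fun φ ψ => hM.map_add _ _ (hb φ) (hb ψ)
      map_smul' := fun c φ => hM.map_mul c _ (hb φ) }
  exact exists_isProbabilityMeasure_integral_eq Λ (fun φ h => hM.nonneg _ (hb φ) fun z => h _)
    hM.map_one

theorem exists_ultrafilter_tendsto_of_mem_closure_range {ι P : Type*} [TopologicalSpace P]
    {k : ι → P} {p : P} (hp : p ∈ closure (range k)) :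
    ∃ W : Ultrafilter ι, Tendsto k W (𝓝 p) := by
  have : (comap k (𝓝 p)).NeBot := by
    rw [comap_neBot_iff]
    intro t ht
    obtain ⟨_, hx, i, rfl⟩ := mem_closure_iff_nhds.1 hp t ht
    exact ⟨i, hx⟩
  exact ⟨Ultrafilter.of _, tendsto_comap_iff.1 ((Ultrafilter.of_le _).trans le_rfl)⟩

/-! ### Convex averages of the rows of an array. -/

/-- Finitely supported probability weights. -/
def IsWeight (w : ℕ →₀ ℝ) : Prop := (∀ i, 0 ≤ w i) ∧ (w.sum fun _ c => c) = 1

section weights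

variable {w : ℕ →₀ ℝ} {f g : ℕ → ℝ} {C : ℝ}

theorem linearCombination_real (f : ℕ → ℝ) (w : ℕ →₀ ℝ) :
    Finsupp.linearCombination ℝ f w = ∑ i ∈ w.support, w i * f i := by
  simp [Finsupp.linearCombination_apply, Finsupp.sum]

theorem IsWeight.linearCombination_const (hw : IsWeight w) (c : ℝ) :
    Finsupp.linearCombination ℝ (fun _ : ℕ => c) w = c := by
  rw [linearCombination_real, ← Finset.sum_mul]
  have : ∑ i ∈ w.support, w i = 1 := hw.2
  rw [this, one_mul]

theorem IsWeight.linearCombination_mono (hw : IsWeight w) (h : ∀ i, f i ≤ g i) :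
    Finsupp.linearCombination ℝ f w ≤ Finsupp.linearCombination ℝ g w := by
  rw [linearCombination_real, linearCombination_real]
  exact Finset.sum_le_sum fun i _ => mul_le_mul_of_nonneg_left (h i) (hw.1 i)

theorem IsWeight.abs_linearCombination_le (hw : IsWeight w) (h : ∀ i, |f i| ≤ C) :
    |Finsupp.linearCombination ℝ f w| ≤ C := by
  rw [abs_le]
  constructor
  · rw [← hw.linearCombination_const (-C)]
    exact hw.linearCombination_mono fun i => (abs_le.1 (h i)).1
  · rw [← hw.linearCombination_const C]
    exact hw.linearCombination_mono fun i => (abs_le.1 (h i)).2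

theorem tendsto_linearCombination {ι : Type*} {l : Filter ι} {F : ι → ℕ → ℝ} (w : ℕ →₀ ℝ)
    (h : ∀ i, Tendsto (fun n => F n i) l (𝓝 (f i))) :
    Tendsto (fun n => Finsupp.linearCombination ℝ (F n) w) l
      (𝓝 (Finsupp.linearCombination ℝ f w)) := by
  simp only [linearCombination_real]
  exact tendsto_finsetSum _ fun i _ => (h i).const_mul _

theorem isMean_ulim_linearCombination (U : Ultrafilter ℕ) {w : ℕ → ℕ →₀ ℝ}
    (hw : ∀ m, IsWeight (w m)) :
    IsMean fun f : ℕ → ℝ => ulim U fun m => Finsupp.linearCombination ℝ f (w m) where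
  map_add f g hf hg := by
    obtain ⟨C, hC⟩ := hf
    obtain ⟨D, hD⟩ := hg
    refine ulim_eq (((tendsto_ulim fun m => (hw m).abs_linearCombination_le hC).add
      (tendsto_ulim fun m => (hw m).abs_linearCombination_le hD)).congr fun m => ?_)
    simp only [linearCombination_real, mul_add, Finset.sum_add_distrib]
  map_mul c f hf := by
    obtain ⟨C, hC⟩ := hf
    refine ulim_eq (((tendsto_ulim fun m => (hw m).abs_linearCombination_le hC).const_mul
      c).congr fun m => ?_)
    simp only [linearCombination_real, Finset.mul_sum]
    exact Finset.sum_congr rfl fun i _ => by ring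
  nonneg f hf h := by
    obtain ⟨C, hC⟩ := hf
    refine ge_of_tendsto' (tendsto_ulim fun m => (hw m).abs_linearCombination_le hC) fun m => ?_
    rw [linearCombination_real]
    exact Finset.sum_nonneg fun i _ => mul_nonneg ((hw m).1 i) (h i)
  map_one := by
    simp only [(hw _).linearCombination_const]
    exact ulim_eq tendsto_const_nhds

end weights

theorem isCompact_closure_range_of_abs_le {a : ℕ → ℕ → ℝ} {C : ℝ} (hC : ∀ i j, |a i j| ≤ C) :
    IsCompact (closure (range a)) := by
  refine (isCompact_univ_pi fun _ : ℕ => isCompact_Icc (a := -C) (b := C)).closure_of_subset ?_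
  rintro _ ⟨i, rfl⟩ j -
  exact abs_le.1 (hC i j)

/-- A point of the closure of the rows of an array, evaluated along an ultrafilter of columns. -/
theorem HasDoubleLimits.ulim_eq_of_tendsto {a : ℕ → ℕ → ℝ} (ha : HasDoubleLimits a)
    {p : ℕ → ℝ} {W : Ultrafilter ℕ} (hW : Tendsto a W (𝓝 p)) (V : Ultrafilter ℕ) :
    ulim V p = ulim W fun i => ulim V (a i) := by
  rw [ha W V]
  congr 1
  funext j
  exact (ulim_eq (tendsto_pi_nhds.1 hW j)).symm

/-- If rows converge to `p` along an ultrafilter, the exchange of limits says exactly that their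
`V`-limits converge to that of `p`. This makes the `V`-limit an admissible continuous integrand on
the closure of the rows. -/
theorem HasDoubleLimits.continuousOn_ulim {a : ℕ → ℕ → ℝ} {C : ℝ} (hC : ∀ i j, |a i j| ≤ C)
    (ha : HasDoubleLimits a) (V : Ultrafilter ℕ) :
    ContinuousOn (fun p : ℕ → ℝ => ulim V p) (closure (range a)) := by
  have key : ∀ p ∈ closure (range a),
      Tendsto (fun p : ℕ → ℝ => ulim V p) (𝓝[range a] p) (𝓝 (ulim V p)) := by
    intro p _
    rw [nhdsWithin, ← map_comap, tendsto_map'_iff, tendsto_iff_ultrafilter]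
    intro W hW
    have hWp : Tendsto a W (𝓝 p) := tendsto_iff_comap.2 hW
    rw [ha.ulim_eq_of_tendsto hWp V]
    exact tendsto_ulim fun i => abs_ulim_le (hC i)
  -- Limits taken along the rows alone suffice: since `ℝ` is regular, the extension by these limits
  -- is continuous on the closure.
  refine (continuousOn_extendFrom subset_rfl fun p hp => ⟨_, key p hp⟩).congr fun p hp => ?_
  exact (extendFrom_eq hp (key p hp)).symm

/-- The values along an ultrafilter are the limits along a suitable sequence, simultaneously for
countably many families. -/
theorem exists_seq_tendsto_ulim (V : Ultrafilter ℕ) (f : ℕ → ℕ → ℝ) (l : ℕ → ℝ)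
    (h : ∀ i, Tendsto (f i) V (𝓝 (l i))) :
    ∃ s : ℕ → ℕ, ∀ i, Tendsto (fun k => f i (s k)) atTop (𝓝 (l i)) := by
  have : Tendsto (fun j i => f i j) V (𝓝 l) := tendsto_pi_nhds.2 h
  have hl : l ∈ closure (range fun j i => f i j) :=
    mem_closure_of_tendsto this (Eventually.of_forall fun j => mem_range_self j)
  obtain ⟨x, hx, hxl⟩ := mem_closure_iff_seq_limit.1 hl
  choose s hs using hx
  refine ⟨s, fun i => ?_⟩
  refine (tendsto_pi_nhds.1 hxl i).congr fun k => ?_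
  rw [← hs k]

/-- Averaging the rows preserves the double limit property. -/
theorem HasDoubleLimits.average {a : ℕ → ℕ → ℝ} {C : ℝ} (hC : ∀ i j, |a i j| ≤ C)
    (ha : HasDoubleLimits a) {w : ℕ → ℕ →₀ ℝ} (hw : ∀ m, IsWeight (w m)) :
    HasDoubleLimits fun m j => Finsupp.linearCombination ℝ (fun i => a i j) (w m) := by
  intro U V
  have hK := isCompact_closure_range_of_abs_le hC
  -- The `U`-limit of the averages is only a finitely additive mean on the rows. Replacing it by a
  -- measure on their closure lets dominated convergence exchange the limits.
  obtain ⟨μ, hμ, hint⟩ := (isMean_ulim_linearCombination U hw).exists_measure a hK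
  have hbd : ∀ p ∈ closure (range a), ∀ j, |p j| ≤ C := by
    intro p hp j
    obtain ⟨W, hW⟩ := exists_ultrafilter_tendsto_of_mem_closure_range hp
    exact le_of_tendsto (tendsto_pi_nhds.1 hW j).abs (Eventually.of_forall fun i => hC i j)
  have h1 : ∀ j, ∫ p : closure (range a), p.1 j ∂μ =
      ulim U fun m => Finsupp.linearCombination ℝ (fun i => a i j) (w m) := fun j =>
    hint ⟨fun p => p.1 j, (continuous_apply j).comp continuous_subtype_val⟩
  have h2 : ∫ p : closure (range a), ulim V p.1 ∂μ =
      ulim U fun m => Finsupp.linearCombination ℝ (fun i => ulim V (a i)) (w m) :=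
    hint ⟨fun p => ulim V p.1, (ha.continuousOn_ulim hC V).domRestrict⟩
  have h3 : ∀ m, ulim V (fun j => Finsupp.linearCombination ℝ (fun i => a i j) (w m)) =
      Finsupp.linearCombination ℝ (fun i => ulim V (a i)) (w m) := fun m =>
    ulim_eq (tendsto_linearCombination _ fun i => tendsto_ulim (hC i))
  simp only [h3, ← h2, ← h1]
  have hγ : Tendsto (fun j => ∫ p : closure (range a), p.1 j ∂μ) V
      (𝓝 (ulim V fun j => ∫ p : closure (range a), p.1 j ∂μ)) := by
    refine tendsto_ulim (C := C) fun j => ?_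
    rw [h1]
    exact abs_ulim_le fun m => (hw m).abs_linearCombination_le fun i => hC i j
  -- Dominated convergence needs a sequence in place of `V`. Index `0` controls the integrals and
  -- index `i + 1` controls row `i`.
  obtain ⟨s, hs⟩ := exists_seq_tendsto_ulim V
    (fun i => Nat.casesOn i (fun j => ∫ p : closure (range a), p.1 j ∂μ) a)
    (fun i => Nat.casesOn i (ulim V fun j => ∫ p : closure (range a), p.1 j ∂μ)
      fun i => ulim V (a i))
    (by rintro (_ | i); exacts [hγ, tendsto_ulim (hC i)])
  have hpt : ∀ p : closure (range a), Tendsto (fun k => p.1 (s k)) atTop (𝓝 (ulim V p.1)) := by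
    intro p
    obtain ⟨W, hW⟩ := exists_ultrafilter_tendsto_of_mem_closure_range p.2
    rw [tendsto_iff_ultrafilter]
    intro T hT
    have hrow : ∀ i, ulim (T.map s) (a i) = ulim V (a i) := fun i =>
      ulim_eq ((hs (i + 1)).mono_left hT)
    -- The ultrafilters `T.map s` and `V` give the same limit on every row, hence on every limit of
    -- rows, by the exchange of limits.
    have : ulim (T.map s) p.1 = ulim V p.1 := by
      rw [ha.ulim_eq_of_tendsto hW, ha.ulim_eq_of_tendsto hW]
      simp only [hrow]
    rw [← this]
    exact tendsto_ulim (U := T.map s) (hbd p.1 p.2)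
  refine tendsto_nhds_unique ?_ (hs 0)
  refine tendsto_integral_of_dominated_convergence (fun _ => C) (fun k => ?_)
    (integrable_const C) (fun k => Eventually.of_forall fun p => hbd p.1 p.2 _)
    (Eventually.of_forall hpt)
  exact ((continuous_apply (s k)).comp continuous_subtype_val).aestronglyMeasurable

/-! ### Weak limits in Hilbert spaces and Mazur's lemma. -/

section Hilbert

variable {H : Type*} [NormedAddCommGroup H] [InnerProductSpace ℝ H]

theorem exists_weak_limit [CompleteSpace H] (U : Ultrafilter ℕ) {v : ℕ → H} {C : ℝ}
    (h : ∀ i, ‖v i‖ ≤ C) :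
    ∃ w : H, ‖w‖ ≤ C ∧ ∀ y, Tendsto (fun i => inner ℝ (v i) y) U (𝓝 (inner ℝ w y)) := by
  have hb : ∀ y i, |inner ℝ (v i) y| ≤ C * ‖y‖ := fun y i =>
    (abs_real_inner_le_norm _ _).trans (mul_le_mul_of_nonneg_right (h i) (norm_nonneg y))
  let φ : H →ₗ[ℝ] ℝ :=
    { toFun := fun y => ulim U fun i => inner ℝ (v i) y
      map_add' := fun y z => ulim_eq (((tendsto_ulim (hb y)).add (tendsto_ulim (hb z))).congr
        fun i => (inner_add_right _ _ _).symm)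
      map_smul' := fun c y => ulim_eq (((tendsto_ulim (hb y)).const_mul c).congr
        fun i => (real_inner_smul_right _ _ _).symm) }
  have hφ : ∀ y, ‖φ y‖ ≤ C * ‖y‖ := fun y => abs_ulim_le (hb y)
  refine ⟨(InnerProductSpace.toDual ℝ H).symm (φ.mkContinuous C hφ), ?_, fun y => ?_⟩
  · rw [LinearIsometryEquiv.norm_map]
    exact φ.mkContinuous_norm_le ((norm_nonneg _).trans (h 0)) hφ
  · rw [InnerProductSpace.toDual_symm_apply]
    exact tendsto_ulim (hb y)

theorem convex_setOf_isWeight : Convex ℝ {w : ℕ →₀ ℝ | IsWeight w} := by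
  intro w hw w' hw' a b ha hb hab
  refine ⟨fun i => ?_, ?_⟩
  · simpa using add_nonneg (mul_nonneg ha (hw.1 i)) (mul_nonneg hb (hw'.1 i))
  · rw [Finsupp.sum_add_index' (fun _ => rfl) (fun _ _ _ => rfl),
      Finsupp.sum_smul_index' (fun _ => rfl), Finsupp.sum_smul_index' (fun _ => rfl)]
    simp only [smul_eq_mul, ← Finsupp.mul_sum]
    rw [hw.2, hw'.2]
    linarith

theorem isWeight_single (i : ℕ) : IsWeight (Finsupp.single i 1) :=
  ⟨fun j => by rw [Finsupp.single_apply]; split_ifs <;> norm_num, by simp⟩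

/-- Mazur's lemma, simultaneously for countably many weakly convergent families. -/
theorem exists_weights_of_weak_limit [CompleteSpace H] (U : Ultrafilter ℕ) {v : ℕ → ℕ → H}
    {w : ℕ → H}
    (h : ∀ t y, Tendsto (fun i => inner ℝ (v t i) y) U (𝓝 (inner ℝ (w t) y))) :
    ∃ c : ℕ → ℕ →₀ ℝ, (∀ m, IsWeight (c m)) ∧ ∀ t m, t ≤ m →
      ‖Finsupp.linearCombination ℝ (v t) (c m) - w t‖ ≤ (1 / 2) ^ m := by
  suffices ∀ m : ℕ, ∃ c : ℕ →₀ ℝ, IsWeight c ∧ ∀ t ≤ m,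
      ‖Finsupp.linearCombination ℝ (v t) c - w t‖ ≤ (1 / 2) ^ m by
    choose c hc hc' using this
    exact ⟨c, hc, fun t m => hc' m t⟩
  intro m
  -- The first `m + 1` families are treated as one family in a finite product, so that a single
  -- convex combination serves them all.
  let vv : ℕ → Fin (m + 1) → H := fun i t => v t i
  let ww : Fin (m + 1) → H := fun t => w t
  have hconv : Convex ℝ (closure (Finsupp.linearCombination ℝ vv '' {c | IsWeight c})) :=
    (convex_setOf_isWeight.linear_image _).closure
  have hmem : ww ∈ closure (Finsupp.linearCombination ℝ vv '' {c | IsWeight c}) := by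
    by_contra hnot
    obtain ⟨f, u, hu, hf⟩ := geometric_hahn_banach_point_closed hconv isClosed_closure hnot
    have hlim : Tendsto (fun i => f (vv i)) U (𝓝 (f ww)) := by
      have hdec : ∀ x : Fin (m + 1) → H,
          f x = ∑ t, inner ℝ (x t) ((InnerProductSpace.toDual ℝ H).symm
            (f.comp (ContinuousLinearMap.single ℝ (fun _ => H) t))) := by
        intro x
        conv_lhs => rw [← Finset.univ_sum_single x, map_sum]
        refine Finset.sum_congr rfl fun t _ => ?_
        rw [real_inner_comm, InnerProductSpace.toDual_symm_apply]
        rfl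
      simp only [hdec]
      exact tendsto_finsetSum _ fun t _ => h t _
    have : u ≤ f ww := ge_of_tendsto' hlim fun i => (hf _ (subset_closure
      ⟨Finsupp.single i 1, isWeight_single i, by simp⟩)).le
    linarith
  obtain ⟨_, ⟨c, hc, rfl⟩, hd⟩ := Metric.mem_closure_iff.1 hmem ((1 / 2) ^ m) (by positivity)
  refine ⟨c, hc, fun t ht => ?_⟩
  rw [dist_comm, dist_eq_norm] at hd
  have h1 := (norm_le_pi_norm (Finsupp.linearCombination ℝ vv c - ww) ⟨t, by omega⟩).trans hd.le
  have h2 : (Finsupp.linearCombination ℝ vv c) ⟨t, by omega⟩ =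
      Finsupp.linearCombination ℝ (v t) c := by
    simp [Finsupp.linearCombination_apply, Finsupp.sum, vv]
  rwa [Pi.sub_apply, h2] at h1

end Hilbert

/-! ### Expectations of random arrays. -/

section L2

variable {Ω : Type*} [MeasurableSpace Ω] {μ : Measure Ω}

theorem coeFn_linearCombination (f : ℕ → Lp ℝ 2 μ) (w : ℕ →₀ ℝ) :
    ∀ᵐ ω ∂μ, Finsupp.linearCombination ℝ f w ω =
      Finsupp.linearCombination ℝ (fun i => f i ω) w := by
  induction w using Finsupp.induction_linear with
  | zero =>
    filter_upwards [Lp.coeFn_zero ℝ 2 μ] with ω hω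
    simp only [map_zero]
    exact hω
  | add w w' h h' =>
    filter_upwards [h, h', Lp.coeFn_add (Finsupp.linearCombination ℝ f w)
      (Finsupp.linearCombination ℝ f w')] with ω h1 h2 h3
    rw [map_add, map_add, h3, Pi.add_apply, h1, h2]
  | single i c =>
    filter_upwards [Lp.coeFn_smul c (f i)] with ω hω
    rw [Finsupp.linearCombination_single, Finsupp.linearCombination_single, hω]
    rfl

variable [IsProbabilityMeasure μ]

/-- Fast convergence in `L²` implies convergence almost everywhere. -/
theorem ae_tendsto_of_norm_sub_le {F : ℕ → Lp ℝ 2 μ} {G : Lp ℝ 2 μ} {t : ℕ}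
    (h : ∀ m, t ≤ m → ‖F m - G‖ ≤ (1 / 2) ^ m) :
    ∀ᵐ ω ∂μ, Tendsto (fun m => F m ω) atTop (𝓝 (G ω)) := by
  have hint : ∀ m, t ≤ m → ∫⁻ ω, ‖(F m - G) ω‖ₑ ∂μ ≤ ENNReal.ofReal ((1 / 2) ^ m) := by
    intro m hm
    rw [← eLpNorm_one_eq_lintegral_enorm]
    refine (eLpNorm_le_eLpNorm_of_exponent_le (by norm_num : (1 : ℝ≥0∞) ≤ 2)
      (Lp.aestronglyMeasurable _)).trans ?_
    rw [← Lp.enorm_def, ← ofReal_norm]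
    exact ENNReal.ofReal_le_ofReal (h m hm)
  -- The `L¹` errors are summable, so the series of pointwise errors is finite almost everywhere and
  -- its terms tend to zero.
  have hsum : ∫⁻ ω, ∑' m, ‖(F (m + t) - G) ω‖ₑ ∂μ ≠ ∞ := by
    rw [lintegral_tsum fun m => (Lp.aestronglyMeasurable _).enorm]
    refine ne_top_of_le_ne_top ?_ (ENNReal.tsum_le_tsum fun m => hint (m + t) (by omega))
    have hs : Summable fun m : ℕ => ((1 : ℝ) / 2) ^ (m + t) :=
      (summable_nat_add_iff t).2 summable_geometric_two
    rw [← ENNReal.ofReal_tsum_of_nonneg (fun m => by positivity) hs]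
    exact ENNReal.ofReal_ne_top
  have hae := ae_lt_top' (AEMeasurable.tsum
    fun m => (Lp.aestronglyMeasurable (F (m + t) - G)).enorm) hsum
  have hsub : ∀ᵐ ω ∂μ, ∀ m, (F m - G) ω = F m ω - G ω := by
    rw [ae_all_iff]
    intro m
    filter_upwards [Lp.coeFn_sub (F m) G] with ω hω using by rw [hω]; rfl
  filter_upwards [hae, hsub] with ω hω hω'
  have h0 := ENNReal.tendsto_atTop_zero_of_tsum_ne_top hω.ne
  rw [tendsto_iff_norm_sub_tendsto_zero, ← tendsto_add_atTop_iff_nat t]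
  simp only [hω'] at h0
  have := (ENNReal.tendsto_toReal ENNReal.zero_ne_top).comp h0
  simpa [Function.comp_def] using this

/-- The expectation of a bounded random array with the double limit property has the double
limit property. -/
theorem hasDoubleLimits_integral {a : Ω → ℕ → ℕ → ℝ} {C : ℝ}
    (hm : ∀ i j, Measurable fun ω => a ω i j) (hC : ∀ ω i j, |a ω i j| ≤ C)
    (ha : ∀ ω, HasDoubleLimits (a ω)) : HasDoubleLimits fun i j => ∫ ω, a ω i j ∂μ := by
  intro U V
  have hL : ∀ i j, MemLp (fun ω => a ω i j) 2 μ := fun i j =>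
    MemLp.of_bound (hm i j).aestronglyMeasurable C (Eventually.of_forall fun ω => hC ω i j)
  have h1L : MemLp (fun _ : Ω => (1 : ℝ)) 2 μ := memLp_const 1
  let A : ℕ → ℕ → Lp ℝ 2 μ := fun i j => (hL i j).toLp
  let e : Lp ℝ 2 μ := h1L.toLp
  have hC0 : 0 ≤ C := by
    obtain ⟨ω⟩ : Nonempty Ω := nonempty_of_isProbabilityMeasure μ
    exact (abs_nonneg _).trans (hC ω 0 0)
  have hA : ∀ i j, ‖A i j‖ ≤ C := fun i j => by
    refine (Lp.norm_le_of_ae_bound (C := C) hC0 ?_).trans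
      (by simp [measureUnivNNReal])
    filter_upwards [(hL i j).coeFn_toLp] with ω hω
    rw [hω]
    exact hC ω i j
  have hAe : ∀ i j, inner ℝ (A i j) e = ∫ ω, a ω i j ∂μ := fun i j => by
    rw [L2.inner_def]
    refine integral_congr_ae ?_
    filter_upwards [(hL i j).coeFn_toLp, h1L.coeFn_toLp] with ω hω hω'
    rw [hω, hω']
    simp
  choose b hb hbw using fun i => exists_weak_limit V (hA i)
  choose c hc hcw using fun j => exists_weak_limit U fun i => hA i j
  obtain ⟨b', -, hb'⟩ := exists_weak_limit U hb
  obtain ⟨c', -, hc'⟩ := exists_weak_limit V hc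
  -- Expectation is the inner product with the constant `e`, so the two iterated limits are the
  -- inner products of `b'` and `c'` with `e`.
  suffices heq : b' = c' by
    simp only [← hAe]
    have e1 : ∀ i, ulim V (fun j => inner ℝ (A i j) e) = inner ℝ (b i) e := fun i =>
      ulim_eq (hbw i e)
    have e2 : ∀ j, ulim U (fun i => inner ℝ (A i j) e) = inner ℝ (c j) e := fun j =>
      ulim_eq (hcw j e)
    simp only [e1, e2]
    rw [ulim_eq (hb' e), ulim_eq (hc' e), heq]
  -- The same weights must work for the row limits `b` (index `0`) and for every column `j` (index
  -- `j + 1`). The weights `wV` play the symmetric role.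
  obtain ⟨wU, hwU, hU⟩ := exists_weights_of_weak_limit U
    (v := fun t => Nat.casesOn t b fun j i => A i j) (w := fun t => Nat.casesOn t b' c)
    (by rintro (_ | t); exacts [hb', hcw t])
  obtain ⟨wV, hwV, hV⟩ := exists_weights_of_weak_limit V
    (v := fun t => Nat.casesOn t c A) (w := fun t => Nat.casesOn t c' b)
    (by rintro (_ | t); exacts [hc', hbw t])
  refine Lp.ext ?_
  have hAa : ∀ᵐ ω ∂μ, ∀ i j, A i j ω = a ω i j := by
    simp only [ae_all_iff]
    exact fun i j => (hL i j).coeFn_toLp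
  have lU0 : ∀ᵐ ω ∂μ, ∀ m, Finsupp.linearCombination ℝ b (wU m) ω =
      Finsupp.linearCombination ℝ (fun i => b i ω) (wU m) :=
    ae_all_iff.2 fun m => coeFn_linearCombination b (wU m)
  have lU : ∀ᵐ ω ∂μ, ∀ j m, Finsupp.linearCombination ℝ (fun i => A i j) (wU m) ω =
      Finsupp.linearCombination ℝ (fun i => A i j ω) (wU m) :=
    ae_all_iff.2 fun j => ae_all_iff.2 fun m => coeFn_linearCombination _ (wU m)
  have lV0 : ∀ᵐ ω ∂μ, ∀ m, Finsupp.linearCombination ℝ c (wV m) ω =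
      Finsupp.linearCombination ℝ (fun i => c i ω) (wV m) :=
    ae_all_iff.2 fun m => coeFn_linearCombination c (wV m)
  have lV : ∀ᵐ ω ∂μ, ∀ i m, Finsupp.linearCombination ℝ (A i) (wV m) ω =
      Finsupp.linearCombination ℝ (fun j => A i j ω) (wV m) :=
    ae_all_iff.2 fun i => ae_all_iff.2 fun m => coeFn_linearCombination _ (wV m)
  have hU0 : ∀ᵐ ω ∂μ, Tendsto (fun m => Finsupp.linearCombination ℝ b (wU m) ω) atTop
      (𝓝 (b' ω)) := ae_tendsto_of_norm_sub_le (hU 0)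
  have hV0 : ∀ᵐ ω ∂μ, Tendsto (fun m => Finsupp.linearCombination ℝ c (wV m) ω) atTop
      (𝓝 (c' ω)) := ae_tendsto_of_norm_sub_le (hV 0)
  filter_upwards [hAa, lU0, lU, lV0, lV, hU0, hV0, ae_all_iff.2 fun j => ae_tendsto_of_norm_sub_le (hU (j + 1)),
    ae_all_iff.2 fun i => ae_tendsto_of_norm_sub_le (hV (i + 1))]
    with ω hAω k1 k2 k3 k4 t1 t2 t3 t4
  simp only [k1, k2, k3, k4, hAω] at t1 t2 t3 t4
  -- At a fixed sample point, averaging both columns and rows gives an array whose iterated limits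
  -- are `b' ω` and `c' ω`.
  have hav : HasDoubleLimits fun m n => Finsupp.linearCombination ℝ
      (fun i => Finsupp.linearCombination ℝ (fun j => a ω i j) (wV n)) (wU m) := by
    have s1 := (ha ω).swap.average (fun j i => hC ω i j) hwV
    exact s1.swap.average (fun i n => (hwV n).abs_linearCombination_le fun j => hC ω i j) hwU
  have hcomm : ∀ m n, Finsupp.linearCombination ℝ
      (fun i => Finsupp.linearCombination ℝ (fun j => a ω i j) (wV n)) (wU m) =
      Finsupp.linearCombination ℝ
      (fun j => Finsupp.linearCombination ℝ (fun i => a ω i j) (wU m)) (wV n) := by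
    intro m n
    simp only [linearCombination_real, Finset.mul_sum]
    rw [Finset.sum_comm]
    exact Finset.sum_congr rfl fun _ _ => Finset.sum_congr rfl fun _ _ => by ring
  have hN : ((hyperfilter ℕ : Ultrafilter ℕ) : Filter ℕ) ≤ atTop := Nat.hyperfilter_le_atTop
  have hdl := hav (hyperfilter ℕ) (hyperfilter ℕ)
  have r1 : ∀ m, ulim (hyperfilter ℕ) (fun n => Finsupp.linearCombination ℝ
      (fun i => Finsupp.linearCombination ℝ (fun j => a ω i j) (wV n)) (wU m)) =
      Finsupp.linearCombination ℝ (fun i => b i ω) (wU m) := fun m =>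
    ulim_eq ((tendsto_linearCombination _ fun i => t4 i).mono_left hN)
  have r2 : ∀ n, ulim (hyperfilter ℕ) (fun m => Finsupp.linearCombination ℝ
      (fun i => Finsupp.linearCombination ℝ (fun j => a ω i j) (wV n)) (wU m)) =
      Finsupp.linearCombination ℝ (fun j => c j ω) (wV n) := fun n => by
    simp only [hcomm]
    exact ulim_eq ((tendsto_linearCombination _ fun j => t3 j).mono_left hN)
  simp only [r1, r2] at hdl
  rwa [ulim_eq (t1.mono_left hN), ulim_eq (t2.mono_left hN)] at hdl

end L2

/-! ### Ultrapowers and finite representability. -/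

section Ultrapower

variable {Y : Type*} [NormedAddCommGroup Y] (p : Ultrafilter ℕ)

open BoundedContinuousFunction in
theorem tendsto_ulim_norm (g : ℕ →ᵇ Y) :
    Tendsto (fun n => ‖g n‖) p (𝓝 (ulim p fun n => ‖g n‖)) :=
  tendsto_ulim (C := ‖g‖) fun n => by rw [abs_norm]; exact g.norm_coe_le_norm n

open BoundedContinuousFunction in
theorem ulim_norm_le (g : ℕ →ᵇ Y) : (ulim p fun n => ‖g n‖) ≤ ‖g‖ :=
  le_of_tendsto' (tendsto_ulim_norm p g) fun n => g.norm_coe_le_norm n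

variable [NormedSpace ℝ Y]

open BoundedContinuousFunction in
/-- The bounded sequences that tend to zero along `p`. -/
def nullSequences (Y : Type*) [NormedAddCommGroup Y] [NormedSpace ℝ Y] (p : Ultrafilter ℕ) :
    Submodule ℝ (ℕ →ᵇ Y) where
  carrier := {g | Tendsto (fun n => g n) p (𝓝 0)}
  add_mem' {f g} hf hg := by simpa using Tendsto.add hf hg
  zero_mem' := tendsto_const_nhds
  smul_mem' c f hf := by simpa using Tendsto.const_smul hf c

open BoundedContinuousFunction in
theorem ulim_norm_eq_of_sub_mem {g h : ℕ →ᵇ Y} (hgh : g - h ∈ nullSequences Y p) :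
    (ulim p fun n => ‖g n‖) = ulim p fun n => ‖h n‖ := by
  have h1 : Tendsto (fun n => ‖h n‖ + ‖(g - h) n‖) p (𝓝 ((ulim p fun n => ‖h n‖) + ‖(0 : Y)‖)) :=
    (tendsto_ulim_norm p h).add (Tendsto.norm hgh)
  have h2 : Tendsto (fun n => ‖h n‖ - ‖(g - h) n‖) p (𝓝 ((ulim p fun n => ‖h n‖) - ‖(0 : Y)‖)) :=
    (tendsto_ulim_norm p h).sub (Tendsto.norm hgh)
  rw [norm_zero, add_zero] at h1
  rw [norm_zero, sub_zero] at h2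
  refine ulim_eq (tendsto_of_tendsto_of_tendsto_of_le_of_le h2 h1 (fun n => ?_) fun n => ?_)
  · have := norm_sub_norm_le (h n) (g n)
    rw [norm_sub_rev] at this
    simp only [BoundedContinuousFunction.coe_sub, Pi.sub_apply]
    linarith
  · have := norm_sub_norm_le (g n) (h n)
    simp only [BoundedContinuousFunction.coe_sub, Pi.sub_apply]
    linarith

/-- Closedness makes the quotient seminorm on the ultrapower a norm. -/
instance isClosed_nullSequences :
    IsClosed (nullSequences Y p : Set (BoundedContinuousFunction ℕ Y)) := by
  rw [isClosed_iff_clusterPt]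
  intro g hg
  rw [← mem_closure_iff_clusterPt] at hg
  change Tendsto (fun n => g n) p (𝓝 0)
  rw [Metric.tendsto_nhds]
  intro ε hε
  obtain ⟨h, hh, hd⟩ := Metric.mem_closure_iff.1 hg (ε / 2) (by positivity)
  filter_upwards [Metric.tendsto_nhds.1 (show Tendsto (fun n => h n) p (𝓝 0) from hh) (ε / 2)
    (by positivity)] with n hn
  calc dist (g n) 0 ≤ dist (g n) (h n) + dist (h n) 0 := dist_triangle _ _ _
    _ < ε / 2 + ε / 2 := add_lt_add ((BoundedContinuousFunction.dist_coe_le_dist n).trans_lt hd) hn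
    _ = ε := by ring

/-- The ultrapower of `Y` along an ultrafilter on `ℕ`. -/
abbrev SeqUltrapower (Y : Type*) [NormedAddCommGroup Y] [NormedSpace ℝ Y] (p : Ultrafilter ℕ) :=
  BoundedContinuousFunction ℕ Y ⧸ nullSequences Y p

theorem norm_mk_seqUltrapower (g : BoundedContinuousFunction ℕ Y) :
    ‖(Submodule.Quotient.mk g : SeqUltrapower Y p)‖ = ulim p fun n => ‖g n‖ := by
  classical
  apply le_antisymm
  · refine le_of_forall_pos_le_add fun ε hε => ?_
    set L := ulim p fun n => ‖g n‖
    have hL : 0 ≤ L := ge_of_tendsto' (tendsto_ulim_norm p g) fun n => norm_nonneg _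
    have hev : ∀ᶠ n in (p : Filter ℕ), ‖g n‖ < L + ε :=
      (tendsto_ulim_norm p g).eventually_lt_const (by linarith)
    -- Setting `g` to zero where its norm is at least `L + ε` leaves its class unchanged and brings
    -- the sup norm down to at most `L + ε`.
    let h : BoundedContinuousFunction ℕ Y := BoundedContinuousFunction.ofNormedAddCommGroup
      (fun n => if ‖g n‖ < L + ε then g n else 0) continuous_of_discreteTopology (L + ε)
      fun n => by
        split_ifs with hn
        · exact hn.le
        · rw [norm_zero]; positivity
    have hgh : (Submodule.Quotient.mk g : SeqUltrapower Y p) = Submodule.Quotient.mk h := by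
      rw [Submodule.Quotient.eq]
      refine Tendsto.congr' (f₁ := fun _ => 0) ?_ tendsto_const_nhds
      filter_upwards [hev] with n hn
      simp [h, hn]
    rw [hgh]
    refine (Submodule.Quotient.norm_mk_le _ h).trans ?_
    refine (BoundedContinuousFunction.norm_le (by positivity)).2 fun n => ?_
    simp only [h, BoundedContinuousFunction.coe_ofNormedAddCommGroup]
    split_ifs with hn
    · exact hn.le
    · rw [norm_zero]; positivity
  · refine le_of_forall_pos_le_add fun ε hε => ?_
    obtain ⟨h, hh, hlt⟩ := Submodule.Quotient.norm_mk_lt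
      (Submodule.Quotient.mk g : SeqUltrapower Y p) hε
    rw [Submodule.Quotient.eq] at hh
    rw [← ulim_norm_eq_of_sub_mem p hh]
    exact (ulim_norm_le p h).trans hlt.le

/-- A linear lift of a finite-dimensional subspace to bounded sequences almost preserves norms at
some single coordinate: finitely many norm conditions, on a net of the unit sphere, hold
simultaneously for `p`-many coordinates. -/
theorem finitelyRepresentable_seqUltrapower : FinitelyRepresentable (SeqUltrapower Y p) Y := by
  intro E _ ε hε
  obtain ⟨r, hr⟩ := ((nullSequences Y p).mkQ).exists_rightInverse_of_surjective
    (Submodule.range_mkQ _)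
  let s : E →L[ℝ] BoundedContinuousFunction ℕ Y := LinearMap.toContinuousLinearMap (r.comp E.subtype)
  have hs : ∀ e : E, ‖e‖ = ulim p fun n => ‖s e n‖ := by
    intro e
    rw [← norm_mk_seqUltrapower]
    have : (Submodule.Quotient.mk (s e) : SeqUltrapower Y p) = e := LinearMap.congr_fun hr e.1
    rw [this]
    rfl
  -- Chosen so that `(1 + η) / (1 - η) = 1 + ε`; the final map is rescaled by `(1 - η)⁻¹`.
  set η : ℝ := ε / (2 + ε) with hη
  have hη0 : 0 < η := by positivity
  have hη1 : 0 < 1 - η := by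
    rw [hη]
    have : 1 - ε / (2 + ε) = 2 / (2 + ε) := by field_simp; ring
    rw [this]
    positivity
  -- The error `η` is split between the mesh of the net, amplified by `‖s‖`, and the error at the
  -- points of the net.
  set δ : ℝ := η / (‖s‖ + 1) with hδ
  have hδ0 : 0 < δ := by positivity
  have hδη : ‖s‖ * δ + δ = η := by rw [hδ]; field_simp
  have : ProperSpace E := FiniteDimensional.proper ℝ E
  obtain ⟨t, htS, htf, htc⟩ := Metric.finite_approx_of_totallyBounded
    (isCompact_sphere (0 : E) 1).totallyBounded δ hδ0
  have hev : ∀ᶠ n in (p : Filter ℕ), ∀ x ∈ t, |‖s x n‖ - 1| < δ := by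
    rw [htf.eventually_all]
    intro x hx
    have h1 : ‖x‖ = 1 := by simpa using htS hx
    have := tendsto_ulim_norm p (s x)
    rw [← hs, h1] at this
    exact Metric.tendsto_nhds.1 this δ hδ0
  obtain ⟨n, hn⟩ := hev.exists
  have hsphere : ∀ e : E, ‖e‖ = 1 → |‖s e n‖ - 1| ≤ η := by
    intro e he
    obtain ⟨x, hx, hex⟩ := mem_iUnion₂.1 (htc (by simpa using he : e ∈ Metric.sphere (0 : E) 1))
    have h1 : |‖s e n‖ - ‖s x n‖| ≤ ‖s‖ * δ := by
      refine (abs_norm_sub_norm_le _ _).trans ?_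
      have : s e n - s x n = s (e - x) n := by rw [map_sub]; rfl
      rw [this]
      refine ((s (e - x)).norm_coe_le_norm n).trans ((s.le_opNorm _).trans ?_)
      refine mul_le_mul_of_nonneg_left ?_ (norm_nonneg _)
      rw [← dist_eq_norm]
      exact (Metric.mem_ball.1 hex).le
    have h2 := (abs_sub_le (‖s e n‖) (‖s x n‖) 1).trans (add_le_add h1 (hn x hx).le)
    rwa [hδη] at h2
  have hall : ∀ e : E, (1 - η) * ‖e‖ ≤ ‖s e n‖ ∧ ‖s e n‖ ≤ (1 + η) * ‖e‖ := by
    intro e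
    rcases eq_or_ne e 0 with rfl | he
    · simp
    have he' : 0 < ‖e‖ := norm_pos_iff.2 he
    have h1 := hsphere (‖e‖⁻¹ • e) (by rw [norm_smul, norm_inv, norm_norm, inv_mul_cancel₀ he'.ne'])
    have h2 : ‖s (‖e‖⁻¹ • e) n‖ = ‖s e n‖ / ‖e‖ := by
      rw [map_smul, BoundedContinuousFunction.coe_smul, norm_smul, norm_inv, norm_norm,
        inv_mul_eq_div]
    rw [h2, abs_le] at h1
    constructor
    · rw [← le_div_iff₀ he']; linarith
    · rw [← div_le_iff₀ he']; linarith
  let ev : BoundedContinuousFunction ℕ Y →ₗ[ℝ] Y :=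
    { toFun := fun g => g n
      map_add' := fun _ _ => rfl
      map_smul' := fun _ _ => rfl }
  refine ⟨(1 - η)⁻¹ • ev.comp s.toLinearMap, fun e => ?_⟩
  have hT : ‖((1 - η)⁻¹ • ev.comp s.toLinearMap) e‖ = (1 - η)⁻¹ * ‖s e n‖ := by
    rw [LinearMap.smul_apply, norm_smul, Real.norm_of_nonneg (inv_nonneg.2 hη1.le)]
    rfl
  rw [hT]
  have h1e : (1 + ε) = (1 - η)⁻¹ * (1 + η) := by
    have : 1 - η = 2 / (2 + ε) := by rw [hη]; field_simp; ring
    rw [this, hη]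
    field_simp
    ring
  constructor
  · rw [← div_eq_inv_mul, le_div_iff₀ hη1, mul_comm]
    exact (hall e).1
  · rw [h1e, mul_assoc]
    exact mul_le_mul_of_nonneg_left (hall e).2 (inv_nonneg.2 hη1.le)

end Ultrapower

/-! ### Truncated distances in stable and superstable spaces. -/

section Truncation

variable {Z : Type*} [NormedAddCommGroup Z] {x y : ℕ → Z} {C : ℝ}

theorem abs_min_norm_le (hC : 0 ≤ C) (z : Z) : |min ‖z‖ C| ≤ C := by
  rw [abs_of_nonneg (le_min (norm_nonneg z) hC)]
  exact min_le_right _ _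

theorem eventually_truncation_eq {U : Ultrafilter ℕ} (hx : ∀ R, ∀ᶠ i in (U : Filter ℕ), R < ‖x i‖)
    (y : Z) : ∀ᶠ i in (U : Filter ℕ), min ‖x i - y‖ C = C := by
  filter_upwards [hx (‖y‖ + C)] with i hi
  have := norm_sub_norm_le (x i) y
  exact min_eq_right (by linarith)

/-- Either `y` is bounded on a set in `V` or it also tends to infinity in norm. In both cases the
relevant distances eventually exceed `C`, and both iterated limits equal `C`. -/
theorem iterated_truncation_of_unbounded {U V : Ultrafilter ℕ}
    (hx : ∀ R, ∀ᶠ i in (U : Filter ℕ), R < ‖x i‖) :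
    (ulim U fun i => ulim V fun j => min ‖x i - y j‖ C) =
      ulim V fun j => ulim U fun i => min ‖x i - y j‖ C := by
  have h2 : ∀ j, (ulim U fun i => min ‖x i - y j‖ C) = C := fun j =>
    (ulim_congr (eventually_truncation_eq hx (y j))).trans (ulim_eq tendsto_const_nhds)
  simp only [h2]
  rw [ulim_eq (f := fun _ => C) tendsto_const_nhds]
  have key : ∀ᶠ i in (U : Filter ℕ), (ulim V fun j => min ‖x i - y j‖ C) = C := by
    by_cases hy : ∃ R, ∀ᶠ j in (V : Filter ℕ), ‖y j‖ ≤ R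
    · obtain ⟨R, hR⟩ := hy
      filter_upwards [hx (R + C)] with i hi
      refine ulim_eq (tendsto_const_nhds.congr' ?_)
      filter_upwards [hR] with j hj
      have := norm_sub_norm_le (x i) (y j)
      exact (min_eq_right (by linarith)).symm
    · push Not at hy
      refine Eventually.of_forall fun i => ulim_eq (tendsto_const_nhds.congr' ?_)
      filter_upwards [eventually_truncation_eq (C := C) hy (x i)] with j hj
      rw [norm_sub_rev, hj]
  exact (ulim_congr key).trans (ulim_eq tendsto_const_nhds)

theorem isBoundedSeq_normMetric (R : ℝ) (h : ∀ i, ‖x i‖ ≤ R) :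
    IsBoundedSeq (normMetric Z) x :=
  ⟨R + R, fun i j => (norm_sub_le _ _).trans (add_le_add (h i) (h j))⟩

theorem exists_forall_norm_le_eventuallyEq {U : Ultrafilter ℕ} {R : ℝ}
    (h : ∀ᶠ i in (U : Filter ℕ), ‖x i‖ ≤ R) :
    ∃ x' : ℕ → Z, IsBoundedSeq (normMetric Z) x' ∧ x' =ᶠ[U] x := by
  classical
  refine ⟨fun i => if ‖x i‖ ≤ R then x i else 0, isBoundedSeq_normMetric |R| fun i => ?_, ?_⟩
  · split_ifs with hi
    · exact hi.trans (le_abs_self R)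
    · simp
  · filter_upwards [h] with i hi
    rw [if_pos hi]

/-- In a stable normed space the truncated distances have the double limit property, also for
unbounded sequences. -/
theorem PseudoMetric.IsStable.hasDoubleLimits_truncation (hZ : (normMetric Z).IsStable)
    (x y : ℕ → Z) (C : ℝ) : HasDoubleLimits fun i j => min ‖x i - y j‖ C := by
  intro U V
  -- Stability concerns nonprincipal ultrafilters only; a principal one is an evaluation and
  -- commutes with any limit.
  by_cases hU : ∃ n, U = pure n
  · obtain ⟨n, rfl⟩ := hU
    simp only [ulim_pure]
  by_cases hV : ∃ n, V = pure n
  · obtain ⟨n, rfl⟩ := hV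
    simp only [ulim_pure]
  push Not at hU hV
  by_cases hx : ∃ R, ∀ᶠ i in (U : Filter ℕ), ‖x i‖ ≤ R
  swap
  · push Not at hx
    exact iterated_truncation_of_unbounded hx
  by_cases hy : ∃ R, ∀ᶠ i in (V : Filter ℕ), ‖y i‖ ≤ R
  swap
  · push Not at hy
    have := iterated_truncation_of_unbounded (x := y) (y := x) (C := C) (U := V) (V := U) hy
    simp only [fun i j => norm_sub_rev (y j) (x i)] at this
    exact this.symm
  obtain ⟨R, hR⟩ := hx
  obtain ⟨S, hS⟩ := hy
  obtain ⟨x', hx', hxx⟩ := exists_forall_norm_le_eventuallyEq hR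
  obtain ⟨y', hy', hyy⟩ := exists_forall_norm_le_eventuallyEq hS
  obtain ⟨g, h, L, hg, hh, hgL, hhL⟩ := hZ x' y' hx' hy' U V hU hV
  have trunc : ∀ {l : Filter ℕ} {f : ℕ → ℝ} {a : ℝ}, Tendsto f l (𝓝 a) →
      Tendsto (fun n => min (f n) C) l (𝓝 (min a C)) := fun hf => hf.min tendsto_const_nhds
  have e1 : ∀ᶠ i in (U : Filter ℕ), min (g i) C = ulim V fun j => min ‖x i - y j‖ C := by
    filter_upwards [hxx] with i hi
    refine (ulim_eq ((trunc (hg i)).congr' ?_)).symm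
    filter_upwards [hyy] with j hj
    rw [← hi, ← hj]
    rfl
  have e2 : ∀ᶠ j in (V : Filter ℕ), min (h j) C = ulim U fun i => min ‖x i - y j‖ C := by
    filter_upwards [hyy] with j hj
    refine (ulim_eq ((trunc (hh j)).congr' ?_)).symm
    filter_upwards [hxx] with i hi
    rw [← hi, ← hj]
    rfl
  rw [ulim_eq ((trunc hgL).congr' e1), ulim_eq ((trunc hhL).congr' e2)]

end Truncation

/-- Pointwise limits of arrays of truncated distances in a superstable space have the double limit
property. -/
theorem IsSuperstable.hasDoubleLimits_of_tendsto {Y : Type*} [NormedAddCommGroup Y]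
    [NormedSpace ℝ Y] [CompleteSpace Y] (hY : IsSuperstable Y) {x y : ℕ → ℕ → Y}
    (hx : ∀ i, ∃ R, ∀ n, ‖x i n‖ ≤ R) (hy : ∀ j, ∃ R, ∀ n, ‖y j n‖ ≤ R) {C : ℝ} {a : ℕ → ℕ → ℝ}
    (ha : ∀ i j, Tendsto (fun n => min ‖x i n - y j n‖ C) atTop (𝓝 (a i j))) :
    HasDoubleLimits a := by
  choose Rx hRx using hx
  choose Ry hRy using hy
  let gx : ℕ → BoundedContinuousFunction ℕ Y := fun i =>
    BoundedContinuousFunction.ofNormedAddCommGroup (x i) continuous_of_discreteTopology (Rx i)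
      (hRx i)
  let gy : ℕ → BoundedContinuousFunction ℕ Y := fun j =>
    BoundedContinuousFunction.ofNormedAddCommGroup (y j) continuous_of_discreteTopology (Ry j)
      (hRy j)
  have hst := hY (SeqUltrapower Y (hyperfilter ℕ)) (finitelyRepresentable_seqUltrapower _)
  have h := hst.hasDoubleLimits_truncation (fun i => Submodule.Quotient.mk (gx i))
    (fun j => Submodule.Quotient.mk (gy j)) C
  have heq : a = fun i j => min ‖(Submodule.Quotient.mk (gx i) : SeqUltrapower Y (hyperfilter ℕ)) -
      Submodule.Quotient.mk (gy j)‖ C := by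
    funext i j
    rw [← Submodule.Quotient.mk_sub, norm_mk_seqUltrapower]
    exact tendsto_nhds_unique ((ha i j).mono_left Nat.hyperfilter_le_atTop)
      ((tendsto_ulim_norm (hyperfilter ℕ) (gx i - gy j)).min tendsto_const_nhds)
  rw [heq]
  exact h

/-! ### Invariant means on abelian groups. -/

section InvariantMean

variable (G : Type*) [AddCommGroup G]

/-- Translation of functions. -/
def translation (g : G) : Module.End ℝ (G → ℝ) := LinearMap.funLeft ℝ ℝ fun z => z + g

/-- The average of the first `n + 1` iterates of a translation. -/
noncomputable def translationAverage (p : G × ℕ) : Module.End ℝ (G → ℝ) :=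
  (1 / (p.2 + 1 : ℝ)) • ∑ k ∈ Finset.range (p.2 + 1), translation G (k • p.1)

/-- The monoid of operators generated by averages of translations. -/
noncomputable def averagingMonoid : Submonoid (Module.End ℝ (G → ℝ)) :=
  Submonoid.closure (range (translationAverage G))

variable {G}

@[simp] theorem translation_apply (g : G) (f : G → ℝ) (z : G) :
    translation G g f z = f (z + g) := rfl

theorem translationAverage_apply (p : G × ℕ) (f : G → ℝ) (z : G) :
    translationAverage G p f z =
      (1 / (p.2 + 1 : ℝ)) * ∑ k ∈ Finset.range (p.2 + 1), f (z + k • p.1) := by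
  simp [translationAverage, LinearMap.sum_apply, Finset.sum_apply]

theorem commute_translation (g h : G) : Commute (translation G g) (translation G h) := by
  refine LinearMap.ext fun f => funext fun z => ?_
  simp [add_right_comm]

theorem commute_translationAverage (p q : G × ℕ) :
    Commute (translationAverage G p) (translationAverage G q) :=
  ((Commute.sum_left _ _ _ fun _ _ => Commute.sum_right _ _ _ fun _ _ =>
    commute_translation _ _).smul_left _).smul_right _

theorem commute_of_mem_averagingMonoid {S T : Module.End ℝ (G → ℝ)} (hS : S ∈ averagingMonoid G)
    (hT : T ∈ averagingMonoid G) : Commute S T := by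
  induction hS, hT using Submonoid.closure_induction₂ with
  | mem x y hx hy =>
    obtain ⟨p, rfl⟩ := hx
    obtain ⟨q, rfl⟩ := hy
    exact commute_translationAverage p q
  | one_left x _ => exact Commute.one_left x
  | one_right x _ => exact Commute.one_right x
  | mul_left x y z _ _ _ h1 h2 => exact h1.mul_left h2
  | mul_right x y z _ _ _ h1 h2 => exact h1.mul_right h2

theorem apply_le_of_mem_averagingMonoid {T : Module.End ℝ (G → ℝ)} (hT : T ∈ averagingMonoid G) :
    ∀ {f : G → ℝ} {c : ℝ}, (∀ z, f z ≤ c) → ∀ z, T f z ≤ c := by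
  induction hT using Submonoid.closure_induction with
  | mem x hx =>
    obtain ⟨⟨g, n⟩, rfl⟩ := hx
    intro f c h z
    rw [translationAverage_apply, one_div, inv_mul_le_iff₀ (by positivity)]
    refine (Finset.sum_le_card_nsmul _ _ c fun k _ => h _).trans_eq ?_
    simp
  | one => exact fun h => h
  | mul x y _ _ hx hy => exact fun h => hx (hy h)

/-- The submodule of bounded functions. -/
def boundedFunctions (G : Type*) : Submodule ℝ (G → ℝ) where
  carrier := {f | IsBoundedFun f}
  add_mem' hf hg := hf.add hg
  zero_mem' := isBoundedFun_const 0
  smul_mem' c _ hf := hf.const_mul c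

/-- The upper bounds of the averages of a function. -/
def averageBounds (f : G → ℝ) : Set ℝ := {c | ∃ T ∈ averagingMonoid G, ∀ z, T f z ≤ c}

theorem bddBelow_averageBounds {f : G → ℝ} (hf : IsBoundedFun f) : BddBelow (averageBounds f) := by
  obtain ⟨C, hC⟩ := hf
  refine ⟨-C, ?_⟩
  rintro c ⟨T, hT, hc⟩
  have h1 := apply_le_of_mem_averagingMonoid hT (f := -f) (c := C)
    (fun z => (neg_le_abs _).trans (hC z)) 0
  rw [map_neg, Pi.neg_apply] at h1
  linarith [hc 0]

theorem mem_averageBounds_of_le {f : G → ℝ} {c : ℝ} (h : ∀ z, f z ≤ c) : c ∈ averageBounds f :=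
  ⟨1, one_mem _, h⟩

theorem nonempty_averageBounds {f : G → ℝ} (hf : IsBoundedFun f) : (averageBounds f).Nonempty := by
  obtain ⟨C, hC⟩ := hf
  exact ⟨C, mem_averageBounds_of_le fun z => (le_abs_self _).trans (hC z)⟩

/-- Commutativity enters here: the product `S * T` serves both functions, since each factor can be
applied first and the other preserves upper bounds. This makes the infimum of the bounds
subadditive, as Hahn–Banach requires. -/
theorem add_mem_averageBounds {f g : G → ℝ} {a b : ℝ} (ha : a ∈ averageBounds f)
    (hb : b ∈ averageBounds g) : a + b ∈ averageBounds (f + g) := by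
  obtain ⟨S, hS, ha⟩ := ha
  obtain ⟨T, hT, hb⟩ := hb
  refine ⟨S * T, mul_mem hS hT, fun z => ?_⟩
  have h1 : (S * T) f z ≤ a := by
    rw [(commute_of_mem_averagingMonoid hS hT).eq]
    exact apply_le_of_mem_averagingMonoid hT ha z
  have h2 : (S * T) g z ≤ b := apply_le_of_mem_averagingMonoid hS hb z
  rw [map_add, Pi.add_apply]
  exact add_le_add h1 h2

theorem smul_mem_averageBounds {f : G → ℝ} {a c : ℝ} (hc : 0 ≤ c) (ha : a ∈ averageBounds f) :
    c * a ∈ averageBounds (c • f) := by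
  obtain ⟨S, hS, ha⟩ := ha
  refine ⟨S, hS, fun z => ?_⟩
  rw [map_smul, Pi.smul_apply, smul_eq_mul]
  exact mul_le_mul_of_nonneg_left (ha z) hc

theorem sInf_averageBounds_smul_le {f : G → ℝ} (hf : IsBoundedFun f) {c : ℝ} (hc : 0 < c) :
    sInf (averageBounds (c • f)) ≤ c * sInf (averageBounds f) := by
  rw [← div_le_iff₀' hc]
  refine le_csInf (nonempty_averageBounds hf) fun a ha => ?_
  rw [div_le_iff₀' hc]
  exact csInf_le (bddBelow_averageBounds (hf.const_mul c)) (smul_mem_averageBounds hc.le ha)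

variable (G)

/-- Abelian groups are amenable. -/
theorem exists_invariant_mean : ∃ M : (G → ℝ) → ℝ, IsMean M ∧
    ∀ f, IsBoundedFun f → ∀ g, M (fun z => f (z + g)) = M f := by
  obtain ⟨Λ, -, hΛ⟩ := exists_extension_of_le_sublinear
    (⊥ : boundedFunctions G →ₗ.[ℝ] ℝ) (fun f => sInf (averageBounds f.1))
    (by
      intro c hc f
      refine le_antisymm (sInf_averageBounds_smul_le f.2 hc) ?_
      have := sInf_averageBounds_smul_le (f := c • f.1) (f.2.const_mul c) (inv_pos.2 hc)
      rw [smul_smul, inv_mul_cancel₀ hc.ne', one_smul, ← div_eq_inv_mul, le_div_iff₀' hc] at this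
      exact this)
    (by
      intro f g
      rw [← sub_le_iff_le_add]
      refine le_csInf (nonempty_averageBounds f.2) fun a ha => ?_
      rw [sub_le_comm]
      refine le_csInf (nonempty_averageBounds g.2) fun b hb => ?_
      rw [sub_le_iff_le_add']
      exact csInf_le (bddBelow_averageBounds (f.2.add g.2)) (add_mem_averageBounds ha hb))
    (by
      rintro ⟨f, hf⟩
      have hf0 : f = 0 := (Submodule.mem_bot ℝ).1 hf
      subst hf0
      have h0 : (⊥ : boundedFunctions G →ₗ.[ℝ] ℝ) ⟨0, hf⟩ = 0 :=
        map_zero (⊥ : boundedFunctions G →ₗ.[ℝ] ℝ).toFun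
      rw [h0]
      refine le_csInf (nonempty_averageBounds (isBoundedFun_const 0)) ?_
      rintro c ⟨T, hT, hc⟩
      have := hc 0
      rwa [show ((⟨(0 : boundedFunctions G), hf⟩ : (⊥ : boundedFunctions G →ₗ.[ℝ] ℝ).domain) :
        boundedFunctions G).1 = 0 from rfl, map_zero] at this)
  -- The values on unbounded functions are arbitrary and play no role.
  obtain ⟨M, hM⟩ := Λ.exists_extend
  have hMΛ : ∀ f (hf : IsBoundedFun f), M f = Λ ⟨f, hf⟩ := fun f hf =>
    LinearMap.congr_fun hM ⟨f, hf⟩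
  have hle : ∀ f c, IsBoundedFun f → c ∈ averageBounds f → M f ≤ c := fun f c hf hc => by
    rw [hMΛ f hf]
    exact (hΛ _).trans (csInf_le (bddBelow_averageBounds hf) hc)
  have hmean : IsMean M :=
    { map_add := fun f g _ _ => M.map_add f g
      map_mul := fun c f _ => M.map_smul c f
      nonneg := fun f hf h => by
        have h1 := hle (-f) 0 ((boundedFunctions G).neg_mem hf)
          (mem_averageBounds_of_le fun z => neg_nonpos.2 (h z))
        rw [map_neg] at h1
        linarith
      map_one := by
        have h1 := hle (fun _ => 1) 1 (isBoundedFun_const 1)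
          (mem_averageBounds_of_le fun z => le_rfl)
        have h2 := hle (-fun _ => 1) (-1) (isBoundedFun_const (-1))
          (mem_averageBounds_of_le fun z => le_rfl)
        rw [map_neg] at h2
        linarith }
  have hsub : ∀ f, IsBoundedFun f → ∀ g, M (f - translation G g f) ≤ 0 := by
    intro f hf g
    have hf' : IsBoundedFun (f - translation G g f) := by
      obtain ⟨C, hC⟩ := hf
      exact IsBoundedFun.sub ⟨C, hC⟩ ⟨C, fun z => hC _⟩
    obtain ⟨C, hC⟩ := hf
    have hlim : Tendsto (fun n : ℕ => (1 / (n + 1 : ℝ)) * (2 * C)) atTop (𝓝 (0 * (2 * C))) :=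
      tendsto_one_div_add_atTop_nhds_zero_nat.mul_const _
    rw [zero_mul] at hlim
    -- Averaging `f - translation G g f` along the multiples of `g` telescopes, leaving two boundary
    -- terms divided by `n + 1`.
    refine ge_of_tendsto' hlim fun n => hle _ _ hf' ⟨_, Submonoid.subset_closure ⟨(g, n), rfl⟩, ?_⟩
    intro z
    rw [translationAverage_apply]
    refine mul_le_mul_of_nonneg_left ?_ (by positivity)
    have : ∀ k : ℕ, (f - translation G g f) (z + k • g) = f (z + k • g) - f (z + (k + 1) • g) :=
      fun k => by simp [succ_nsmul, add_assoc]
    simp only [this]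
    rw [Finset.sum_range_sub' fun k : ℕ => f (z + k • g)]
    linarith [le_abs_self (f (z + 0 • g)), hC (z + 0 • g), neg_le_abs (f (z + (n + 1) • g)),
      hC (z + (n + 1) • g)]
  refine ⟨M, hmean, fun f hf g => le_antisymm ?_ ?_⟩
  · have h1 := hsub (translation G g f) (by obtain ⟨C, hC⟩ := hf; exact ⟨C, fun z => hC _⟩) (-g)
    have h2 : translation G (-g) (translation G g f) = f := by ext z; simp
    rw [h2, map_sub] at h1
    change M (translation G g f) ≤ M f
    linarith
  · have h1 := hsub f hf g
    rw [map_sub] at h1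
    change M f ≤ M (translation G g f)
    linarith

end InvariantMean

/-! ### Removing the truncation. -/

section Tails

variable {ι : Type*} {M : (ι → ℝ) → ℝ}

/-- The mass that escapes to infinity along `U`. -/
noncomputable def escapingMass (M : (ι → ℝ) → ℝ) (U : Ultrafilter ℕ) (a : ℕ → ι → ℝ) : ℝ :=
  (ulim U fun i => M (a i)) - ⨆ C : ℝ, ulim U fun i => M fun z => min (a i z) C

theorem IsBoundedFun.min_const {f : ι → ℝ} (hf : IsBoundedFun f) (C : ℝ) :
    IsBoundedFun fun z => min (f z) C := by
  obtain ⟨B, hB⟩ := hf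
  refine ⟨max B |C|, fun z => ?_⟩
  dsimp only
  rcases min_choice (f z) C with h | h <;> rw [h]
  · exact (hB z).trans (le_max_left _ _)
  · exact le_max_right _ _

theorem IsBoundedFun.max_sub {f : ι → ℝ} (hf : IsBoundedFun f) (C : ℝ) :
    IsBoundedFun fun z => max (f z - C) 0 := by
  obtain ⟨B, hB⟩ := hf
  refine ⟨B + |C|, fun z => ?_⟩
  have h1 := abs_le.1 (hB z)
  have h2 := neg_abs_le C
  have h3 := abs_nonneg C
  rw [abs_of_nonneg (le_max_right _ _)]
  exact max_le (by linarith) (by linarith)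

variable {a b : ℕ → ι → ℝ} {S : ℝ} {U V : Ultrafilter ℕ}

theorem IsMean.abs_map_min_le (hM : IsMean M) (ha0 : ∀ i z, 0 ≤ a i z)
    (hab : ∀ i, IsBoundedFun (a i)) (haS : ∀ i, M (a i) ≤ S) (C : ℝ) (i : ℕ) :
    |M fun z => min (a i z) C| ≤ S + |C| := by
  have hS : 0 ≤ S := (hM.nonneg _ (hab i) (ha0 i)).trans (haS i)
  have h1 : M (fun z => min (a i z) C) ≤ S :=
    (hM.mono ((hab i).min_const C) (hab i) fun z => min_le_left _ _).trans (haS i)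
  have h2 : -|C| ≤ M fun z => min (a i z) C :=
    hM.const_le ((hab i).min_const C) fun z => le_min
      ((neg_nonpos.2 (abs_nonneg C)).trans (ha0 i z)) (neg_abs_le C)
  exact abs_le.2 ⟨by linarith, by linarith [abs_nonneg C]⟩

theorem IsMean.abs_map_le (hM : IsMean M) (ha0 : ∀ i z, 0 ≤ a i z)
    (hab : ∀ i, IsBoundedFun (a i)) (haS : ∀ i, M (a i) ≤ S) (i : ℕ) : |M (a i)| ≤ S := by
  rw [abs_of_nonneg (hM.nonneg _ (hab i) (ha0 i))]
  exact haS i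

theorem IsMean.tendsto_ulim_min (hM : IsMean M) (ha0 : ∀ i z, 0 ≤ a i z)
    (hab : ∀ i, IsBoundedFun (a i)) (haS : ∀ i, M (a i) ≤ S) (U : Ultrafilter ℕ) :
    Tendsto (fun C : ℝ => ulim U fun i => M fun z => min (a i z) C) atTop
      (𝓝 (⨆ C : ℝ, ulim U fun i => M fun z => min (a i z) C)) := by
  refine tendsto_atTop_ciSup (fun C D hCD => ?_) ⟨S, ?_⟩
  · exact le_of_tendsto_of_tendsto' (tendsto_ulim (hM.abs_map_min_le ha0 hab haS C))
      (tendsto_ulim (hM.abs_map_min_le ha0 hab haS D)) fun i =>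
      hM.mono ((hab i).min_const C) ((hab i).min_const D) fun z => min_le_min_left _ hCD
  · rintro _ ⟨C, rfl⟩
    exact le_of_tendsto' (tendsto_ulim (hM.abs_map_min_le ha0 hab haS C)) fun i =>
      (hM.mono ((hab i).min_const C) (hab i) fun z => min_le_left _ _).trans (haS i)

/-- Where `b ≤ E` the `b`-terms add up to `min b D - b ≤ 0`, and `n ≥ a - b` suffices. Where `b ≥ E`
the error term is at least `2 * c + C`, which absorbs `a`, and `n ≥ b - a` suffices. -/
theorem tail_lower_bound {a b c n C D E : ℝ} (ha : 0 ≤ a) (hac : a ≤ c) (hb : 0 ≤ b) (hC : 0 ≤ C)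
    (hD : 0 ≤ D) (hDE : D ≤ E) (hE : 0 < E) (hn1 : a - b ≤ n) (hn2 : b - a ≤ n) :
    (a - min a (C + D)) + (b - 2 * min b E + min b D) - (2 * c + C) / E * b ≤ max (n - C) 0 := by
  have hc : 0 ≤ c := ha.trans hac
  have hcE : 0 ≤ (2 * c + C) / E := by positivity
  rcases le_total b E with hbE | hbE
  · have h0 : 0 ≤ (2 * c + C) / E * b := by positivity
    rw [min_eq_left hbE]
    have h1 : n - C ≤ max (n - C) 0 := le_max_left _ _
    have h2 : 0 ≤ max (n - C) 0 := le_max_right _ _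
    rcases le_total a (C + D) with h | h <;> rcases le_total b D with h' | h' <;>
      simp only [min_eq_left, min_eq_right, h, h'] <;> linarith
  · have h0 : 2 * c + C ≤ (2 * c + C) / E * b := by
      rw [div_mul_eq_mul_div, le_div_iff₀ hE]
      exact mul_le_mul_of_nonneg_left hbE (by linarith)
    rw [min_eq_right hbE, min_eq_right (hDE.trans hbE)]
    have h1 : n - C ≤ max (n - C) 0 := le_max_left _ _
    have h3 : 0 ≤ min a (C + D) := le_min ha (by linarith)
    linarith

/-- An excess of `n` over `2 * C` is at most the sum of the excesses of `a` and `b` over `C`. -/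
theorem tail_upper_bound {a b n C : ℝ} (hn : n ≤ a + b) :
    max (n - 2 * C) 0 ≤ (a - min a C) + (b - min b C) := by
  have h1 := min_le_left a C
  have h2 := min_le_left b C
  have h3 := min_le_right a C
  have h4 := min_le_right b C
  exact max_le (by linarith) (by linarith)

variable {n : ℕ → ℕ → ι → ℝ}

/-- For fixed `i` the function `a i` is bounded, while by Markov's inequality the part of `b j`
above a high level `E` sits where `a i` has small mean. The large parts are thus asymptotically
disjoint and their excesses add. The limit is symmetric in the two sequences, which is the point. -/
theorem IsMean.tendsto_iterated_tail (hM : IsMean M) (ha0 : ∀ i z, 0 ≤ a i z)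
    (hab : ∀ i, IsBoundedFun (a i)) (haS : ∀ i, M (a i) ≤ S) (hb0 : ∀ i z, 0 ≤ b i z)
    (hbb : ∀ i, IsBoundedFun (b i)) (hbS : ∀ i, M (b i) ≤ S)
    (hn1 : ∀ i j z, a i z - b j z ≤ n i j z) (hn2 : ∀ i j z, b j z - a i z ≤ n i j z)
    (hn3 : ∀ i j z, n i j z ≤ a i z + b j z) :
    Tendsto (fun C : ℝ => ulim U fun i => ulim V fun j => M fun z => max (n i j z - 2 * C) 0)
      atTop (𝓝 (escapingMass M U a + escapingMass M V b)) := by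
  have hn0 : ∀ i j z, 0 ≤ n i j z := fun i j z => by linarith [hn1 i j z, hn2 i j z]
  have hnb : ∀ i j, IsBoundedFun (n i j) := fun i j => by
    obtain ⟨C, hC⟩ := (hab i).add (hbb j)
    exact isBoundedFun_of_nonneg_of_le (hn0 i j) fun z =>
      (hn3 i j z).trans ((le_abs_self _).trans (hC z))
  have hnS : ∀ i j, M (n i j) ≤ S + S := fun i j =>
    (hM.mono (hnb i j) ((hab i).add (hbb j)) (hn3 i j)).trans
      ((hM.map_add _ _ (hab i) (hbb j)).trans_le (add_le_add (haS i) (hbS j)))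
  have hr : ∀ C, 0 ≤ C → ∀ i j, |M fun z => max (n i j z - C) 0| ≤ S + S := fun C hC i j => by
    rw [abs_of_nonneg (hM.nonneg _ ((hnb i j).max_sub C) fun z => le_max_right _ _)]
    exact (hM.mono ((hnb i j).max_sub C) (hnb i j) fun z =>
      max_le (by linarith) (hn0 i j z)).trans (hnS i j)
  have lim_a := tendsto_ulim (U := U) (hM.abs_map_le ha0 hab haS)
  have lim_b := tendsto_ulim (U := V) (hM.abs_map_le hb0 hbb hbS)
  have lim_ma := fun C => tendsto_ulim (U := U) (hM.abs_map_min_le ha0 hab haS C)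
  have lim_mb := fun C => tendsto_ulim (U := V) (hM.abs_map_min_le hb0 hbb hbS C)
  have sup_a := hM.tendsto_ulim_min ha0 hab haS U
  have sup_b := hM.tendsto_ulim_min hb0 hbb hbS V
  have lim_r := fun C hC i => tendsto_ulim (U := V) (hr C hC i)
  have lim_rr := fun C hC => tendsto_ulim (U := U) (C := S + S)
    (f := fun i => ulim V fun j => M fun z => max (n i j z - C) 0) fun i => abs_ulim_le (hr C hC i)
  unfold escapingMass
  set τ := ulim U fun i => M (a i)
  set σ := ulim V fun j => M (b j)
  set τs := ⨆ C : ℝ, ulim U fun i => M fun z => min (a i z) C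
  set σs := ⨆ C : ℝ, ulim V fun i => M fun z => min (b i z) C
  have upper : ∀ C, 0 ≤ C →
      (ulim U fun i => ulim V fun j => M fun z => max (n i j z - 2 * C) 0) ≤
        (τ - ulim U fun i => M fun z => min (a i z) C) +
          (σ - ulim V fun j => M fun z => min (b j z) C) := by
    intro C hC
    refine le_of_tendsto_of_tendsto' (lim_rr (2 * C) (by positivity))
      ((lim_a.sub (lim_ma C)).add_const _) fun i => ?_
    refine le_of_tendsto_of_tendsto' (lim_r (2 * C) (by positivity) i)
      ((lim_b.sub (lim_mb C)).const_add _) fun j => ?_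
    rw [← hM.map_sub (hab i) ((hab i).min_const C), ← hM.map_sub (hbb j) ((hbb j).min_const C),
      ← hM.map_add _ _ ((hab i).sub ((hab i).min_const C)) ((hbb j).sub ((hbb j).min_const C))]
    exact hM.mono ((hnb i j).max_sub _) (((hab i).sub ((hab i).min_const C)).add
      ((hbb j).sub ((hbb j).min_const C))) fun z => tail_upper_bound (hn3 i j z)
  have lower : ∀ C, 0 ≤ C → (τ - τs) + (σ - σs) ≤
      ulim U fun i => ulim V fun j => M fun z => max (n i j z - C) 0 := by
    intro C hC
    -- The order of limits matters: `j` first, then `E → ∞` with `i` fixed, because the bound `c`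
    -- depends on `i`. The term `0 * σ` is the limit of the error.
    have step2 : ∀ D, 0 ≤ D → ∀ i, (M (a i) - M fun z => min (a i z) (C + D)) +
        (σ - 2 * σs + ulim V fun j => M fun z => min (b j z) D) - 0 * σ ≤
        ulim V fun j => M fun z => max (n i j z - C) 0 := by
      intro D hD i
      obtain ⟨c, hc⟩ := hab i
      have hac : ∀ z, a i z ≤ c := fun z => (le_abs_self _).trans (hc z)
      have hE : Tendsto (fun E : ℝ => (2 * c + C) / E) atTop (𝓝 0) :=
        tendsto_const_nhds.div_atTop tendsto_id
      refine le_of_tendsto ((((sup_b.const_mul 2).const_sub σ).add_const _).const_add _ |>.sub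
        (hE.mul_const σ)) ?_
      filter_upwards [eventually_ge_atTop D, eventually_gt_atTop 0] with E hDE hE0
      refine le_of_tendsto_of_tendsto' (((((lim_b.sub ((lim_mb E).const_mul 2)).add
        (lim_mb D)).const_add _)).sub (lim_b.const_mul _)) (lim_r C hC i) fun j => ?_
      have b1 := (hab i).sub ((hab i).min_const (C + D))
      have b2 := (hbb j).sub (((hbb j).min_const E).const_mul 2)
      have b3 := b2.add ((hbb j).min_const D)
      have b4 := (hbb j).const_mul ((2 * c + C) / E)
      rw [← hM.map_sub (hab i) ((hab i).min_const _), ← hM.map_mul 2 _ ((hbb j).min_const E),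
        ← hM.map_sub (hbb j) (((hbb j).min_const E).const_mul 2),
        ← hM.map_add _ _ b2 ((hbb j).min_const D), ← hM.map_add _ _ b1 b3,
        ← hM.map_mul _ _ (hbb j), ← hM.map_sub (b1.add b3) b4]
      exact hM.mono ((b1.add b3).sub b4) ((hnb i j).max_sub C) fun z =>
        tail_lower_bound (ha0 i z) (hac z) (hb0 j z) hC hD hDE hE0 (hn1 i j z) (hn2 i j z)
    have step3 : ∀ D, 0 ≤ D → (τ - ulim U fun i => M fun z => min (a i z) (C + D)) +
        (σ - 2 * σs + ulim V fun j => M fun z => min (b j z) D) - 0 * σ ≤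
        ulim U fun i => ulim V fun j => M fun z => max (n i j z - C) 0 := fun D hD =>
      le_of_tendsto_of_tendsto' (((lim_a.sub (lim_ma (C + D))).add_const _).sub_const _)
        (lim_rr C hC) (step2 D hD)
    -- As `D → ∞` the expression `σ - 2 * σs + ulim V …` tends to `σ - σs`.
    have hlim := ((((sup_a.comp (tendsto_atTop_add_const_left atTop C tendsto_id)).const_sub
      τ).add (sup_b.const_add (σ - 2 * σs))).sub_const (0 * σ))
    have := le_of_tendsto hlim ((eventually_ge_atTop (0 : ℝ)).mono step3)
    linarith
  refine tendsto_of_tendsto_of_tendsto_of_le_of_le' tendsto_const_nhds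
    ((sup_a.const_sub τ).add (sup_b.const_sub σ)) ?_ ?_
  · filter_upwards [eventually_ge_atTop 0] with C hC using lower (2 * C) (by positivity)
  · filter_upwards [eventually_ge_atTop 0] with C hC using upper C hC

/-- If the truncated means have the double limit property, so do the means. -/
theorem IsMean.hasDoubleLimits_of_truncation (hM : IsMean M) (ha0 : ∀ i z, 0 ≤ a i z)
    (hab : ∀ i, IsBoundedFun (a i)) (haS : ∀ i, M (a i) ≤ S) (hb0 : ∀ i z, 0 ≤ b i z)
    (hbb : ∀ i, IsBoundedFun (b i)) (hbS : ∀ i, M (b i) ≤ S)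
    (hn1 : ∀ i j z, a i z - b j z ≤ n i j z) (hn2 : ∀ i j z, b j z - a i z ≤ n i j z)
    (hn3 : ∀ i j z, n i j z ≤ a i z + b j z)
    (h : ∀ C, 0 ≤ C → HasDoubleLimits fun i j => M fun z => min (n i j z) C) :
    HasDoubleLimits fun i j => M (n i j) := by
  intro U V
  have hn0 : ∀ i j z, 0 ≤ n i j z := fun i j z => by linarith [hn1 i j z, hn2 i j z]
  have hnb : ∀ i j, IsBoundedFun (n i j) := fun i j => by
    obtain ⟨C, hC⟩ := (hab i).add (hbb j)
    exact isBoundedFun_of_nonneg_of_le (hn0 i j) fun z =>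
      (hn3 i j z).trans ((le_abs_self _).trans (hC z))
  have hnS : ∀ i j, M (n i j) ≤ S + S := fun i j =>
    (hM.mono (hnb i j) ((hab i).add (hbb j)) (hn3 i j)).trans
      ((hM.map_add _ _ (hab i) (hbb j)).trans_le (add_le_add (haS i) (hbS j)))
  have hsplit : ∀ C i j, M (n i j) =
      (M fun z => min (n i j z) C) + M fun z => max (n i j z - C) 0 := fun C i j => by
    rw [← hM.map_add _ _ ((hnb i j).min_const C) ((hnb i j).max_sub C)]
    congr 1
    funext z
    rcases le_total (n i j z) C with h | h
    · rw [min_eq_left h, max_eq_right (by linarith), add_zero]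
    · rw [min_eq_right h, max_eq_left (by linarith)]
      ring
  have hr : ∀ C, 0 ≤ C → ∀ i j, |M fun z => max (n i j z - C) 0| ≤ S + S := fun C hC i j => by
    rw [abs_of_nonneg (hM.nonneg _ ((hnb i j).max_sub C) fun z => le_max_right _ _)]
    exact (hM.mono ((hnb i j).max_sub C) (hnb i j) fun z =>
      max_le (by linarith) (hn0 i j z)).trans (hnS i j)
  have ht : ∀ C, 0 ≤ C → ∀ i j, |M fun z => min (n i j z) C| ≤ C := fun C hC i j => by
    rw [abs_of_nonneg (hM.nonneg _ ((hnb i j).min_const C) fun z => le_min (hn0 i j z) hC)]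
    exact hM.le_const ((hnb i j).min_const C) fun z => min_le_right _ _
  have e1 : ∀ C, 0 ≤ C → (ulim U fun i => ulim V fun j => M (n i j)) =
      (ulim U fun i => ulim V fun j => M fun z => min (n i j z) C) +
        ulim U fun i => ulim V fun j => M fun z => max (n i j z - C) 0 := fun C hC => by
    simp only [hsplit C]
    have inner : ∀ i, (ulim V fun j => (M fun z => min (n i j z) C) +
        M fun z => max (n i j z - C) 0) = (ulim V fun j => M fun z => min (n i j z) C) +
        ulim V fun j => M fun z => max (n i j z - C) 0 := fun i =>
      ulim_eq ((tendsto_ulim (ht C hC i)).add (tendsto_ulim (hr C hC i)))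
    simp only [inner]
    exact ulim_eq ((tendsto_ulim fun i => abs_ulim_le (ht C hC i)).add
      (tendsto_ulim fun i => abs_ulim_le (hr C hC i)))
  have e2 : ∀ C, 0 ≤ C → (ulim V fun j => ulim U fun i => M (n i j)) =
      (ulim V fun j => ulim U fun i => M fun z => min (n i j z) C) +
        ulim V fun j => ulim U fun i => M fun z => max (n i j z - C) 0 := fun C hC => by
    simp only [hsplit C]
    have inner : ∀ j, (ulim U fun i => (M fun z => min (n i j z) C) +
        M fun z => max (n i j z - C) 0) = (ulim U fun i => M fun z => min (n i j z) C) +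
        ulim U fun i => M fun z => max (n i j z - C) 0 := fun j =>
      ulim_eq ((tendsto_ulim fun i => ht C hC i j).add (tendsto_ulim fun i => hr C hC i j))
    simp only [inner]
    exact ulim_eq ((tendsto_ulim fun j => abs_ulim_le fun i => ht C hC i j).add
      (tendsto_ulim fun j => abs_ulim_le fun i => hr C hC i j))
  have l1 := hM.tendsto_iterated_tail (U := U) (V := V) ha0 hab haS hb0 hbb hbS hn1 hn2 hn3
  have l2 := hM.tendsto_iterated_tail (U := V) (V := U) (n := fun j i => n i j) hb0 hbb hbS ha0 hab
    haS (fun j i => hn2 i j) (fun j i => hn1 i j) fun j i z => (hn3 i j z).trans_eq (add_comm _ _)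
  have l3 := l1.sub l2
  -- The truncated parts cancel at every level, so the difference of the iterated limits equals a
  -- difference of tails, which tends to zero.
  rw [add_comm (escapingMass M V b), sub_self] at l3
  refine sub_eq_zero.1 (tendsto_nhds_unique (tendsto_const_nhds.congr' ?_) l3)
  filter_upwards [eventually_ge_atTop 0] with C hC
  rw [e1 (2 * C) (by positivity), e2 (2 * C) (by positivity), h (2 * C) (by positivity) U V]
  ring

end Tails

/-! ### Means of distances in a superstable space. -/

/-- Means of truncated distances in a superstable space have the double limit property. -/
theorem IsSuperstable.hasDoubleLimits_mean_truncation {ι Y : Type*} [NormedAddCommGroup Y]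
    [NormedSpace ℝ Y] [CompleteSpace Y] (hY : IsSuperstable Y) {M : (ι → ℝ) → ℝ} (hM : IsMean M)
    {x y : ℕ → ι → Y} (hx : ∀ i, IsBoundedFun fun z => ‖x i z‖)
    (hy : ∀ j, IsBoundedFun fun z => ‖y j z‖) {C : ℝ} (hC : 0 ≤ C) :
    HasDoubleLimits fun i j => M fun z => min ‖x i z - y j z‖ C := by
  let k : ι → ℕ → ℕ → ℝ := fun z i j => min ‖x i z - y j z‖ C
  have hbox : IsCompact (univ.pi fun _ : ℕ => univ.pi fun _ : ℕ => Icc (-C) C) :=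
    isCompact_univ_pi fun _ => isCompact_univ_pi fun _ => isCompact_Icc
  have hsub : closure (range k) ⊆ univ.pi fun _ : ℕ => univ.pi fun _ : ℕ => Icc (-C) C := by
    refine closure_minimal ?_ hbox.isClosed
    rintro _ ⟨z, rfl⟩ i - j -
    exact abs_le.1 (abs_min_norm_le hC _)
  obtain ⟨μ, hμ, hint⟩ := hM.exists_measure k (hbox.of_isClosed_subset isClosed_closure hsub)
  have hcont : ∀ i j, Continuous fun ω : closure (range k) => ω.1 i j := fun i j =>
    (continuous_apply j).comp ((continuous_apply i).comp continuous_subtype_val)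
  have key : HasDoubleLimits fun i j => ∫ ω : closure (range k), ω.1 i j ∂μ := by
    refine hasDoubleLimits_integral (C := C) (fun i j => (hcont i j).measurable)
      (fun ω i j => abs_le.2 (hsub ω.2 i trivial j trivial)) fun ω => ?_
    -- The space of arrays is metrizable, so a sequence of parameters `z` reaches `ω`. Evaluation
    -- along it turns each `x i` and `y j` into a bounded sequence in `Y`, an element of the
    -- ultrapower.
    obtain ⟨u, hu, hlim⟩ := mem_closure_iff_seq_limit.1 ω.2
    choose z hz using hu
    refine hY.hasDoubleLimits_of_tendsto (x := fun i n => x i (z n)) (y := fun j n => y j (z n))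
      (C := C) (fun i => ?_) (fun j => ?_) fun i j => ?_
    · obtain ⟨R, hR⟩ := hx i
      exact ⟨R, fun n => (le_abs_self _).trans (hR (z n))⟩
    · obtain ⟨R, hR⟩ := hy j
      exact ⟨R, fun n => (le_abs_self _).trans (hR (z n))⟩
    · refine (tendsto_pi_nhds.1 (tendsto_pi_nhds.1 hlim i) j).congr fun n => ?_
      rw [← hz n]
  convert key using 3 with i j
  exact (hint ⟨_, hcont i j⟩).symm

/-- Means of distances in a superstable space have the double limit property. -/
theorem IsSuperstable.hasDoubleLimits_mean {ι Y : Type*} [NormedAddCommGroup Y]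
    [NormedSpace ℝ Y] [CompleteSpace Y] (hY : IsSuperstable Y) {M : (ι → ℝ) → ℝ} (hM : IsMean M)
    {x y : ℕ → ι → Y} {S : ℝ} (hx : ∀ i, IsBoundedFun fun z => ‖x i z‖)
    (hy : ∀ j, IsBoundedFun fun z => ‖y j z‖) (hxS : ∀ i, (M fun z => ‖x i z‖) ≤ S)
    (hyS : ∀ j, (M fun z => ‖y j z‖) ≤ S) :
    HasDoubleLimits fun i j => M fun z => ‖x i z - y j z‖ :=
  hM.hasDoubleLimits_of_truncation (n := fun i j z => ‖x i z - y j z‖)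
    (fun _ _ => norm_nonneg _) hx hxS (fun _ _ => norm_nonneg _) hy hyS
    (fun _ _ _ => norm_sub_norm_le _ _)
    (fun i j z => by rw [norm_sub_rev]; exact norm_sub_norm_le _ _)
    (fun _ _ _ => norm_sub_le _ _) fun _ hC => hY.hasDoubleLimits_mean_truncation hM hx hy hC

/-! ### The averaged pseudometric. -/

section Averaging

variable {X Y : Type*} [NormedAddCommGroup X] [NormedAddCommGroup Y]

theorem normMetric_apply (x y : X) : normMetric X x y = ‖x - y‖ := rfl

theorem IsCoarse.isBoundedFun {f : X → Y} (hf : IsCoarse (normMetric X) (normMetric Y) f)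
    (x y : X) : IsBoundedFun fun z => ‖f (x + z) - f (y + z)‖ := by
  refine ⟨(expansionModulus (normMetric X) (normMetric Y) f ‖x - y‖).toReal, fun z => ?_⟩
  rw [abs_norm, ← ENNReal.ofReal_le_iff_le_toReal (hf _ (norm_nonneg _)).ne]
  exact le_iSup_of_le (x + z) (le_iSup_of_le (y + z) (le_iSup_of_le
    (by rw [normMetric_apply, add_sub_add_right_eq_sub]) le_rfl))

/-- The average of the pseudometrics `(x, y) ↦ ‖f (x + z) - f (y + z)‖` over `z`. -/
noncomputable def averagedMetric {M : (X → ℝ) → ℝ} (hM : IsMean M) {f : X → Y}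
    (hf : IsCoarse (normMetric X) (normMetric Y) f) : PseudoMetric X ℝ where
  toFun x y := M fun z => ‖f (x + z) - f (y + z)‖
  refl' x := by simpa using hM.map_const 0
  symm' x y := by simp only [norm_sub_rev]
  triangle' x y w := by
    rw [← hM.map_add _ _ (hf.isBoundedFun x y) (hf.isBoundedFun y w)]
    exact hM.mono (hf.isBoundedFun x w) ((hf.isBoundedFun x y).add (hf.isBoundedFun y w))
      fun z => norm_sub_le_norm_sub_add_norm_sub _ _ _

variable {M : (X → ℝ) → ℝ} (hM : IsMean M) {f : X → Y}
  (hf : IsCoarse (normMetric X) (normMetric Y) f)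

theorem averagedMetric_apply (x y : X) :
    averagedMetric hM hf x y = M fun z => ‖f (x + z) - f (y + z)‖ := rfl

theorem averagedMetric_isTranslationInvariant
    (hinv : ∀ φ, IsBoundedFun φ → ∀ g, M (fun z => φ (z + g)) = M φ) :
    (averagedMetric hM hf).IsTranslationInvariant := by
  intro x y
  rw [averagedMetric_apply, averagedMetric_apply, ← hinv _ (hf.isBoundedFun (x - y) 0) y]
  congr 1
  funext z
  rw [zero_add, add_comm z y, ← add_assoc, sub_add_cancel]

theorem compressionModulus_le_averagedMetric (x y : X) :
    compressionModulus (normMetric X) (normMetric Y) f ‖x - y‖ ≤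
      ENNReal.ofReal (averagedMetric hM hf x y) := by
  have h : ∀ z, compressionModulus (normMetric X) (normMetric Y) f ‖x - y‖ ≤
      ENNReal.ofReal ‖f (x + z) - f (y + z)‖ := fun z =>
    iInf_le_of_le (x + z) (iInf_le_of_le (y + z) (iInf_le_of_le
      (by rw [normMetric_apply, add_sub_add_right_eq_sub]) le_rfl))
  -- The compression modulus is finite here because the pair `(x, y)` itself competes in the
  -- infimum.
  rw [← ENNReal.ofReal_toReal (ne_top_of_le_ne_top ENNReal.ofReal_ne_top (h 0))]
  refine ENNReal.ofReal_le_ofReal (hM.const_le (hf.isBoundedFun x y) fun z => ?_)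
  exact ENNReal.toReal_le_of_le_ofReal (norm_nonneg _) (h z)

theorem averagedMetric_le_expansionModulus (x y : X) :
    ENNReal.ofReal (averagedMetric hM hf x y) ≤
      expansionModulus (normMetric X) (normMetric Y) f ‖x - y‖ := by
  have hfin := (hf _ (norm_nonneg (x - y))).ne
  rw [← ENNReal.ofReal_toReal hfin]
  refine ENNReal.ofReal_le_ofReal (hM.le_const (hf.isBoundedFun x y) fun z => ?_)
  rw [← ENNReal.ofReal_le_iff_le_toReal hfin]
  exact le_iSup_of_le (x + z) (le_iSup_of_le (y + z) (le_iSup_of_le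
    (by rw [normMetric_apply, add_sub_add_right_eq_sub]) le_rfl))

theorem averagedMetric_isStable [NormedSpace ℝ Y] [CompleteSpace Y] (hY : IsSuperstable Y) :
    (averagedMetric hM hf).IsStable := by
  have hzero : ∀ x : ℕ → X, IsBoundedSeq (averagedMetric hM hf) x →
      ∃ S, ∀ i, averagedMetric hM hf (x i) 0 ≤ S := by
    rintro x ⟨C, hC⟩
    exact ⟨C + averagedMetric hM hf (x 0) 0, fun i =>
      ((averagedMetric hM hf).triangle' (x i) (x 0) 0).trans (add_le_add_left (hC i 0) _)⟩
  intro x y hx hy U V _ _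
  obtain ⟨R, hR⟩ := hzero x hx
  obtain ⟨S, hS⟩ := hzero y hy
  have hbd : ∀ i j, |averagedMetric hM hf (x i) (y j)| ≤ R + S := fun i j => by
    rw [averagedMetric_apply, abs_of_nonneg (hM.nonneg _ (hf.isBoundedFun _ _) fun z =>
      norm_nonneg _), ← averagedMetric_apply hM hf]
    refine ((averagedMetric hM hf).triangle' (x i) 0 (y j)).trans (add_le_add (hR i) ?_)
    exact ((averagedMetric hM hf).symm' 0 (y j)).trans_le (hS j)
  have hdl : HasDoubleLimits fun i j => averagedMetric hM hf (x i) (y j) := by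
    -- Subtracting `f (0 + z)` from both families leaves their differences unchanged and makes the
    -- mean norms equal to distances to `0`, which are bounded. Without it neither family need be
    -- bounded in `z`.
    have := hY.hasDoubleLimits_mean hM (x := fun i z => f (x i + z) - f (0 + z))
      (y := fun j z => f (y j + z) - f (0 + z)) (S := max R S)
      (fun i => hf.isBoundedFun (x i) 0) (fun j => hf.isBoundedFun (y j) 0)
      (fun i => (hR i).trans (le_max_left _ _)) (fun j => (hS j).trans (le_max_right _ _))
    simp only [sub_sub_sub_cancel_right] at this
    exact this
  refine ⟨fun i => ulim V fun j => averagedMetric hM hf (x i) (y j),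
    fun j => ulim U fun i => averagedMetric hM hf (x i) (y j), _,
    fun i => tendsto_ulim (hbd i), fun j => tendsto_ulim fun i => hbd i j,
    tendsto_ulim fun i => abs_ulim_le (hbd i), ?_⟩
  rw [hdl U V]
  exact tendsto_ulim fun j => abs_ulim_le fun i => hbd i j

/-- A pseudometric squeezed between the moduli of a coarse embedding is coarsely equivalent to the
norm. -/
theorem IsCoarseEmbedding.isCoarseEquivalence_id
    (hf : IsCoarseEmbedding (normMetric X) (normMetric Y) f) {d : PseudoMetric X ℝ}
    (hd : ∀ x y : X,
      compressionModulus (normMetric X) (normMetric Y) f ‖x - y‖ ≤ ENNReal.ofReal (d x y) ∧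
      ENNReal.ofReal (d x y) ≤ expansionModulus (normMetric X) (normMetric Y) f ‖x - y‖) :
    IsCoarseEquivalence (normMetric X) d (id : X → X) := by
  refine ⟨⟨fun t ht => ?_, ?_⟩, ?_⟩
  · refine lt_of_le_of_lt (iSup_le fun x => iSup_le fun y => iSup_le fun hxy => ?_) (hf.1 t ht)
    refine (hd x y).2.trans (iSup_le fun u => iSup_le fun v => iSup_le fun huv => ?_)
    exact le_iSup_of_le u (le_iSup_of_le v (le_iSup_of_le (huv.trans hxy) le_rfl))
  · refine tendsto_of_tendsto_of_tendsto_of_le_of_le hf.2 tendsto_const_nhds (fun t => ?_)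
      fun t => le_top
    refine le_iInf fun x => le_iInf fun y => le_iInf fun hxy => le_trans ?_ (hd x y).1
    refine le_iInf fun u => le_iInf fun v => le_iInf fun huv => ?_
    exact iInf_le_of_le u (iInf_le_of_le v (iInf_le_of_le (le_trans hxy huv) le_rfl))
  · refine lt_of_le_of_lt (iSup_le fun y => iInf_le_of_le y (le_of_eq ?_)) ENNReal.zero_lt_top
    exact (congrArg ENNReal.ofReal (d.refl' y)).trans ENNReal.ofReal_zero

end Averaging

theorem mainTheorem4 {X Y : Type*}
    [NormedAddCommGroup X] [NormedSpace ℝ X] [CompleteSpace X]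
    [NormedAddCommGroup Y] [NormedSpace ℝ Y] [CompleteSpace Y]
    (hY : IsSuperstable Y) :
    (∀ f : X → Y, IsCoarse (normMetric X) (normMetric Y) f →
      ∃ d : PseudoMetric X ℝ, d.IsTranslationInvariant ∧ d.IsStable ∧
        ∀ x y : X,
          compressionModulus (normMetric X) (normMetric Y) f ‖x - y‖ ≤ ENNReal.ofReal (d x y) ∧
          ENNReal.ofReal (d x y) ≤ expansionModulus (normMetric X) (normMetric Y) f ‖x - y‖) ∧
    ((∃ f : X → Y, IsCoarseEmbedding (normMetric X) (normMetric Y) f) →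
      ∃ d : PseudoMetric X ℝ, d.IsTranslationInvariant ∧ d.IsStable ∧
        IsCoarseEquivalence (normMetric X) d (id : X → X)) := by
  obtain ⟨M, hM, hinv⟩ := exists_invariant_mean X
  refine ⟨fun f hf => ⟨averagedMetric hM hf, averagedMetric_isTranslationInvariant hM hf hinv,
    averagedMetric_isStable hM hf hY, fun x y => ⟨compressionModulus_le_averagedMetric hM hf x y,
      averagedMetric_le_expansionModulus hM hf x y⟩⟩, ?_⟩
  rintro ⟨f, hf⟩
  exact ⟨averagedMetric hM hf.1, averagedMetric_isTranslationInvariant hM hf.1 hinv,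
    averagedMetric_isStable hM hf.1 hY, hf.isCoarseEquivalence_id fun x y =>
      ⟨compressionModulus_le_averagedMetric hM hf.1 x y,
        averagedMetric_le_expansionModulus hM hf.1 x y⟩⟩
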